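/- Let $d\ge 1$ be an integer, let $B=B(0,1)\subset\mathbb{R}^d$ be the open unit ball and let $c>0$. For $f\in W^{1,d}(B;\mathbb{R}^d)$, with weak gradient $\nabla f$, set $$\|f\|_{W^{1,d}}^d=\int_B |f|^d\,dx+\int_B|\nabla f|^d\,dx,$$ where $|f|$ is the Euclidean norm and $|\nabla f|=\big(\sum_{i,j}(\partial_j f_i)^2\big)^{1/2}$ is the Frobenius norm. As $f$ is a class of functions modulo equality almost everywhere, $\mathrm{Vol}(f(B))$ denotes the infimum of the (outer) Lebesgue measures of $g(B)$ over all representatives $g$ of $f$; it equals the measure of $g(B)$ for every representative $g$ that maps null sets to null sets (for instance, whenever $f$ has a locally Lipschitz representative $g$). Let $$\mathcal{A}_c=\Big\{f\in W^{1,d}(B;\mathbb{R}^d):\int_B\det\nabla f\,dx=c\Big\},\qquad \mathcal{B}_c=\big\{f\in W^{1,d}(B;\mathbb{R}^d):\mathrm{Vol}(f(B))=c\big\}.$$ Then $$\inf_{f\in\mathcal{A}_c}\|f\|_{W^{1,d}}^d=\inf_{f\in\mathcal{B}_c}\|f\|_{W^{1,d}}^d=d^{d/2}\,c,$$ and neither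 infimum is attained. -/

import Mathlib

open MeasureTheory Set Metric
open scoped ENNReal ContDiff

noncomputable section

/-- Euclidean space `ℝ^d`. -/
abbrev Euc (d : ℕ) : Type := EuclideanSpace ℝ (Fin d)

/-- The open unit ball `B(0,1)` of `ℝ^d`. -/
abbrev unitBall (d : ℕ) : Set (Euc d) := ball (0 : Euc d) 1

/-- Lebesgue measure on the unit ball of `ℝ^d`. -/
abbrev ballMeasure (d : ℕ) : Measure (Euc d) := (volume : Measure (Euc d)).restrict (unitBall d)

/-- The space `L^d(B(0,1); ℝ^d)` (of classes of functions modulo equality almost everywhere). -/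
abbrev LdBall (d : ℕ) : Type := Lp (Euc d) (d : ℝ≥0∞) (ballMeasure d)

/-- `G` is a weak gradient of `f` on the unit ball: `G x i j` is the weak partial derivative of the
`i`-th component of `f` in the direction of the `j`-th coordinate. -/
def IsWeakGradient {d : ℕ} (f : Euc d → Euc d) (G : Euc d → Matrix (Fin d) (Fin d) ℝ) : Prop :=
  ∀ (i j : Fin d) (φ : Euc d → ℝ), ContDiff ℝ ∞ φ → HasCompactSupport φ →
    tsupport φ ⊆ unitBall d →
    ∫ x in unitBall d, f x i * fderiv ℝ φ x (EuclideanSpace.single j 1) =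
      - ∫ x in unitBall d, G x i j * φ x

/-- `G` is a weak gradient of `f` on the unit ball all of whose entries are in `L^d(B(0,1))`. -/
def IsLdWeakGradient {d : ℕ} (f : Euc d → Euc d) (G : Euc d → Matrix (Fin d) (Fin d) ℝ) : Prop :=
  (∀ i j, MemLp (fun x => G x i j) (d : ℝ≥0∞) (ballMeasure d)) ∧ IsWeakGradient f G

/-- The Sobolev space `W^{1,d}(B(0,1); ℝ^d)`, as a subset of `L^d(B(0,1); ℝ^d)`. -/
def sobolevW1d (d : ℕ) : Set (LdBall d) := {f | ∃ G, IsLdWeakGradient f G}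

open Classical in
/-- The weak gradient `∇f` of `f ∈ W^{1,d}(B(0,1); ℝ^d)`; it is determined up to equality almost
everywhere on the ball (see `IsLdWeakGradient.ae_eq`), and set to `0` if `f` is not in the space. -/
def weakGradient {d : ℕ} (f : LdBall d) : Euc d → Matrix (Fin d) (Fin d) ℝ :=
  if h : ∃ G, IsLdWeakGradient f G then h.choose else 0

/-- The Frobenius (Hilbert-Schmidt) norm of a square matrix. -/
def frobeniusNorm {d : ℕ} (A : Matrix (Fin d) (Fin d) ℝ) : ℝ := Real.sqrt (∑ i, ∑ j, A i j ^ 2)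

/-- `‖f‖_{W^{1,d}}^d = ∫ |f|^d + ∫ |∇f|^d` over the unit ball, with the Euclidean norm of vectors
and the Frobenius norm of matrices. -/
def sobolevEnergy {d : ℕ} (f : LdBall d) : ℝ :=
  (∫ x in unitBall d, ‖f x‖ ^ d) + ∫ x in unitBall d, frobeniusNorm (weakGradient f x) ^ d

/-- The volume of the image of the unit ball under a class of functions modulo equality almost
everywhere: the infimum of the volumes of the images `g(B(0,1))` over all representatives `g`. It equals the
volume of `g(B(0,1))` for every representative `g` that maps null sets to null sets
(see `imageVolume_eq`). -/
def imageVolume {d : ℕ} (f : Euc d → Euc d) : ℝ≥0∞ :=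
  ⨅ (g : Euc d → Euc d) (_ : g =ᵐ[ballMeasure d] f), volume (g '' unitBall d)

/-- The maps in `W^{1,d}(B(0,1); ℝ^d)` with `∫ det ∇f = c`. -/
def classA (d : ℕ) (c : ℝ) : Set (LdBall d) :=
  {f | f ∈ sobolevW1d d ∧ ∫ x in unitBall d, (weakGradient f x).det = c}

/-- The maps in `W^{1,d}(B(0,1); ℝ^d)` with `Vol(f(B(0,1))) = c`. -/
def classB (d : ℕ) (c : ℝ) : Set (LdBall d) :=
  {f | f ∈ sobolevW1d d ∧ imageVolume f = ENNReal.ofReal c}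

/-- The weak gradient is unique up to equality almost everywhere. -/
theorem IsLdWeakGradient.ae_eq {d : ℕ} (hd : 1 ≤ d) {f : Euc d → Euc d}
    {G H : Euc d → Matrix (Fin d) (Fin d) ℝ} (hG : IsLdWeakGradient f G)
    (hH : IsLdWeakGradient f H) : G =ᵐ[ballMeasure d] H := by
  have hd' : (1 : ℝ≥0∞) ≤ (d : ℝ≥0∞) := by exact_mod_cast hd
  have : IsFiniteMeasure (ballMeasure d) := ⟨by
    rw [Measure.restrict_apply_univ]; exact measure_ball_lt_top⟩
  have key : ∀ i j, ∀ᵐ x ∂(ballMeasure d), G x i j = H x i j := by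
    intro i j
    have iG : IntegrableOn (fun x => G x i j) (unitBall d) := (hG.1 i j).integrable hd'
    have iH : IntegrableOn (fun x => H x i j) (unitBall d) := (hH.1 i j).integrable hd'
    have h := isOpen_ball.ae_eq_zero_of_integral_contDiff_smul_eq_zero (μ := volume)
      (iG.sub iH).locallyIntegrableOn (U := unitBall d) (by
        intro φ h1 h2 h3
        obtain ⟨C, hC⟩ := h1.continuous.bounded_above_of_compact_support h2
        have jG : IntegrableOn (fun x => G x i j * φ x) (unitBall d) :=
          iG.mul_bdd h1.continuous.aestronglyMeasurable (Filter.Eventually.of_forall hC)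
        have jH : IntegrableOn (fun x => H x i j * φ x) (unitBall d) :=
          iH.mul_bdd h1.continuous.aestronglyMeasurable (Filter.Eventually.of_forall hC)
        rw [← setIntegral_eq_integral_of_forall_compl_eq_zero (s := unitBall d)]
        · have e1 := hG.2 i j φ h1 h2 h3
          have e2 := hH.2 i j φ h1 h2 h3
          have e3 := integral_sub jG jH
          have : ∀ x, φ x • ((fun x => G x i j) - fun x => H x i j) x
              = G x i j * φ x - H x i j * φ x := by
            intro x; simp only [Pi.sub_apply, smul_eq_mul]; ring
          simp only [this]
          linarith
        · intro x hx
          have : φ x = 0 := image_eq_zero_of_notMem_tsupport fun h => hx (h3 h)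
          simp [this])
    rw [ae_restrict_iff' measurableSet_ball]
    filter_upwards [h] with x hx hx'
    simpa [sub_eq_zero] using hx hx'
  have := ae_all_iff.2 fun i => ae_all_iff.2 (key i)
  filter_upwards [this] with x hx
  ext i j
  exact hx i j

/-- If a representative maps null sets to null sets, then the volume of the image of the class is
the volume of the image of this representative. -/
theorem imageVolume_eq {d : ℕ} {f g : Euc d → Euc d} (hg : g =ᵐ[ballMeasure d] f)
    (hN : ∀ N ⊆ unitBall d, volume N = 0 → volume (g '' N) = 0) :
    imageVolume f = volume (g '' unitBall d) := by
  refine le_antisymm (iInf₂_le g hg) (le_iInf₂ fun k hk => ?_)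
  have hgk : ∀ᵐ x ∂(volume : Measure (Euc d)), x ∈ unitBall d → g x = k x :=
    (ae_restrict_iff' measurableSet_ball).1 (hg.trans hk.symm)
  have hnull : volume {x | x ∈ unitBall d ∧ g x ≠ k x} = 0 := by
    simpa [ae_iff] using hgk
  have hsub : g '' unitBall d ⊆ k '' unitBall d ∪ g '' {x | x ∈ unitBall d ∧ g x ≠ k x} := by
    rintro _ ⟨x, hx, rfl⟩
    by_cases h : g x = k x
    · exact Or.inl ⟨x, hx, h.symm⟩
    · exact Or.inr ⟨x, ⟨hx, h⟩, rfl⟩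
  calc volume (g '' unitBall d) ≤ _ := measure_mono hsub
    _ ≤ _ := measure_union_le _ _
    _ = volume (k '' unitBall d) := by rw [hN _ (fun x hx => hx.1) hnull, add_zero]

end

/-! Hadamard's inequality in the form `d^(d/2) |det A| ≤ |A|^d` bounds the energy below by `∫ |f|^d
+ d^(d/2) ∫ |det ∇f|`, and in both classes `∫ |det ∇f| ≥ c`. Equality would force `f = 0`, hence `∇f
= 0` and `∫ |det ∇f| = 0 < c`; so neither infimum is attained (`mul_lt_sobolevEnergy`).

For the class with prescribed determinant integral the bound on `∫ |det ∇f|` is immediate. For the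
class with prescribed volume it is the area inequality `IsLdWeakGradient.imageVolume_le`. A map in
`W^{1,d}` may send null sets to sets of positive measure, but the volume is an infimum over
representatives, so `f` may be set to `0` on a null set. It then suffices that almost all of the
ball is a countable union of sets relative to which `f` is differentiable with derivative `∇f`
(`exists_hasFDerivWithinAt_of_weakGradient`). This is a Lusin-type theorem: the increments of a fast
sequence of mollifications are Lipschitz, with geometrically small constants, off sets where the
maximal function of their gradients is large, and the weak (1,1) inequality makes these sets small.

For sharpness, Hadamard's inequality is an equality for conformal matrices. Inversions centred at `p
= (1 + t) e`, just outside the ball, are injective and conformal; after a reflection they preserve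
orientation and so, suitably scaled, lie in both classes. As `t → 0` the Jacobian concentrates at
the boundary point `e` and `∫ |f|^d` tends to `0` (`exists_sobolevEnergy_le`). -/

noncomputable section

/-! ### Truncated maximal function and pointwise Lipschitz estimates -/

section MaximalFunction

/-- The set of points where the Hardy-Littlewood maximal function of `h` over radii at most `δ` is
larger than `a`. -/
def maximalSuperlevel {E : Type*} [PseudoMetricSpace E] [MeasurableSpace E] (μ : Measure E)
    (h : E → ℝ≥0∞) (δ : ℝ) (a : ℝ≥0∞) : Set E :=
  {x | ∃ ρ, 0 < ρ ∧ ρ ≤ δ ∧ a * μ (closedBall x ρ) < ∫⁻ y in closedBall x ρ, h y ∂μ}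

theorem maximalSuperlevel_mono {E : Type*} [PseudoMetricSpace E] [MeasurableSpace E]
    {μ : Measure E} (h : E → ℝ≥0∞) {δ δ' : ℝ} (hδ : δ ≤ δ') (a : ℝ≥0∞) :
    maximalSuperlevel μ h δ a ⊆ maximalSuperlevel μ h δ' a :=
  fun _ ⟨ρ, h0, h1, h2⟩ => ⟨ρ, h0, h1.trans hδ, h2⟩

variable {E : Type*} [NormedAddCommGroup E] [NormedSpace ℝ E] [FiniteDimensional ℝ E]
  [MeasurableSpace E] [BorelSpace E] (μ : Measure E) [μ.IsAddHaarMeasure]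

/-- The weak type `(1,1)` inequality for the maximal function. -/
theorem mul_measure_maximalSuperlevel_le (h : E → ℝ≥0∞) (δ : ℝ) (a : ℝ≥0∞) :
    a * μ (maximalSuperlevel μ h δ a) ≤
      ENNReal.ofReal (5 ^ Module.finrank ℝ E) * ∫⁻ y, h y ∂μ := by
  set S := maximalSuperlevel μ h δ a with hS
  have hex : ∀ x : E, ∃ ρ : ℝ, x ∈ S →
      (0 < ρ ∧ ρ ≤ δ ∧ a * μ (closedBall x ρ) < ∫⁻ y in closedBall x ρ, h y ∂μ) := by
    intro x
    by_cases hx : x ∈ S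
    · obtain ⟨ρ, hρ⟩ := hx
      exact ⟨ρ, fun _ => hρ⟩
    · exact ⟨0, fun h => (hx h).elim⟩
  choose r hr using hex
  -- Truncating the radii at `δ` supplies the bound that Vitali's lemma needs; its enlargement
  -- factor 5 produces the constant `5 ^ n`.
  obtain ⟨u, huS, hdisj, hcov⟩ := Vitali.exists_disjoint_subfamily_covering_enlargement_closedBall
    S (fun x => x) r δ (fun x hx => (hr x hx).2.1) 5 (by norm_num)
  have hcount : u.Countable := hdisj.countable_of_nonempty_interior fun x hx =>
    ⟨x, ball_subset_interior_closedBall (mem_ball_self (hr x (huS hx)).1)⟩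
  have hsub : S ⊆ ⋃ b ∈ u, closedBall b (5 * r b) := by
    intro x hx
    obtain ⟨b, hb, hxb⟩ := hcov x hx
    exact mem_biUnion hb (hxb (mem_closedBall_self (hr x hx).1.le))
  calc a * μ S ≤ a * ∑' b : u, μ (closedBall (b : E) (5 * r b)) := by
        gcongr
        exact (measure_mono hsub).trans (measure_biUnion_le μ hcount _)
    _ = ∑' b : u, ENNReal.ofReal (5 ^ Module.finrank ℝ E) * (a * μ (closedBall (b : E) (r b))) := by
        rw [← ENNReal.tsum_mul_left]
        refine tsum_congr fun b => ?_
        have hb := (hr b (huS b.2)).1.le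
        have e : μ (closedBall (b : E) (r b)) = μ (closedBall 0 (r b)) := by
          simpa using Measure.addHaar_closedBall_mul μ (b : E) zero_le_one hb
        rw [Measure.addHaar_closedBall_mul μ _ (by norm_num) hb, e]
        ring
    _ ≤ ∑' b : u, ENNReal.ofReal (5 ^ Module.finrank ℝ E) *
          ∫⁻ y in closedBall (b : E) (r b), h y ∂μ := by
        gcongr with b
        exact (hr b (huS b.2)).2.2.le
    _ = ENNReal.ofReal (5 ^ Module.finrank ℝ E) *
          ∫⁻ y in ⋃ b ∈ u, closedBall b (r b), h y ∂μ := by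
        rw [ENNReal.tsum_mul_left,
          lintegral_biUnion hcount (fun _ _ => measurableSet_closedBall) hdisj]
    _ ≤ _ := by
        exact mul_le_mul_right (setLIntegral_le_lintegral _ _) _

variable {μ}

/-- Change of variables for the dilation of centre `x` and ratio `t`. It turns an average along
segments issuing from `x` into an average over a smaller concentric ball, which the maximal function
controls. -/
theorem setLIntegral_closedBall_homothety (h : E → ℝ≥0∞) (x : E) {ρ t : ℝ} (ht : 0 < t) :
    ENNReal.ofReal (t ^ Module.finrank ℝ E) * ∫⁻ z in closedBall x ρ, h (x + t • (z - x)) ∂μ =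
      ∫⁻ z in closedBall x (t * ρ), h z ∂μ := by
  have hder : ∀ z ∈ closedBall x ρ, HasFDerivWithinAt (fun z => x + t • (z - x))
      (t • ContinuousLinearMap.id ℝ E) (closedBall x ρ) z := fun z _ =>
    ((((hasFDerivAt_id z).sub_const x).const_smul t).const_add x).hasFDerivWithinAt
  have hinj : InjOn (fun z => x + t • (z - x)) (closedBall x ρ) := by
    intro y _ z _ hyz
    simpa [ht.ne'] using hyz
  have himg : (fun z => x + t • (z - x)) '' closedBall x ρ = closedBall x (t * ρ) := by
    ext y
    simp only [mem_image, mem_closedBall, dist_eq_norm]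
    constructor
    · rintro ⟨z, hz, rfl⟩
      rw [add_sub_cancel_left, norm_smul, Real.norm_of_nonneg ht.le]
      gcongr
    · intro hy
      refine ⟨x + t⁻¹ • (y - x), ?_, ?_⟩
      · rw [add_sub_cancel_left, norm_smul, norm_inv, Real.norm_of_nonneg ht.le]
        rwa [inv_mul_le_iff₀ ht]
      · simp [smul_smul, ht.ne']
  rw [← himg, lintegral_image_eq_lintegral_abs_det_fderiv_mul μ measurableSet_closedBall hder hinj]
  have hdet : |(t • ContinuousLinearMap.id ℝ E).det| = t ^ Module.finrank ℝ E := by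
    rw [ContinuousLinearMap.det]
    simp [abs_of_pos ht]
  simp_rw [hdet]
  rw [lintegral_const_mul' _ _ ENNReal.ofReal_ne_top]

/-- Integrate the gradient along the segment from `x` to `z` and exchange the integrals. For fixed
`t` the inner integral becomes, by dilation, one over the ball of radius `t * ρ ≤ ρ`, whose average
is at most `a` because `x` is outside the superlevel set. -/
theorem setLIntegral_closedBall_enorm_sub_le {v : E → ℝ} (hv : ContDiff ℝ 1 v) {h : E → ℝ≥0∞}
    (hh : Measurable h) {x : E} {ρ : ℝ} {a : ℝ≥0∞} (hρ : 0 < ρ)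
    (hvh : ∀ y ∈ closedBall x ρ, ‖fderiv ℝ v y‖ₑ ≤ h y)
    (hx : x ∉ maximalSuperlevel μ h ρ a) :
    ∫⁻ z in closedBall x ρ, ‖v z - v x‖ₑ ∂μ ≤ ENNReal.ofReal ρ * a * μ (closedBall x ρ) := by
  have hpt : ∀ z ∈ closedBall x ρ, ‖v z - v x‖ₑ ≤
      ∫⁻ t in Icc (0 : ℝ) 1, ENNReal.ofReal ρ * h (x + t • (z - x)) := by
    intro z hz
    have hcd : ContDiff ℝ 1 (fun t : ℝ => v (x + t • (z - x))) := by fun_prop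
    have := enorm_sub_le_lintegral_deriv_of_contDiffOn_Icc hcd.contDiffOn zero_le_one
    simp only [one_smul, add_sub_cancel, zero_smul, add_zero] at this
    refine this.trans (setLIntegral_mono' measurableSet_Icc fun t ht => ?_)
    have hmem : x + t • (z - x) ∈ closedBall x ρ := by
      rw [mem_closedBall, dist_eq_norm, add_sub_cancel_left, norm_smul, Real.norm_of_nonneg ht.1]
      rw [mem_closedBall, dist_eq_norm] at hz
      calc t * ‖z - x‖ ≤ 1 * ρ := by gcongr; exact ht.2
        _ = ρ := one_mul _
    have hd : HasDerivAt (fun t : ℝ => v (x + t • (z - x)))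
        (fderiv ℝ v (x + t • (z - x)) (z - x)) t := by
      have h1 : HasDerivAt (fun t : ℝ => x + t • (z - x)) (z - x) t := by
        simpa using ((hasDerivAt_id t).smul_const (z - x)).const_add x
      exact ((hv.differentiable (by norm_num)) _).hasFDerivAt.comp_hasDerivAt t h1
    rw [hd.deriv]
    refine (ContinuousLinearMap.le_opENorm _ _).trans ?_
    rw [mul_comm]
    gcongr
    · rw [← ofReal_norm]
      rw [mem_closedBall, dist_eq_norm] at hz
      exact ENNReal.ofReal_le_ofReal hz
    · exact hvh _ hmem
  calc ∫⁻ z in closedBall x ρ, ‖v z - v x‖ₑ ∂μ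
      ≤ ∫⁻ z in closedBall x ρ, ∫⁻ t in Icc (0 : ℝ) 1,
          ENNReal.ofReal ρ * h (x + t • (z - x)) ∂volume ∂μ :=
        setLIntegral_mono' measurableSet_closedBall hpt
    _ = ∫⁻ t in Icc (0 : ℝ) 1, ∫⁻ z in closedBall x ρ,
          ENNReal.ofReal ρ * h (x + t • (z - x)) ∂μ ∂volume := by
        apply lintegral_lintegral_swap
        apply Measurable.aemeasurable
        have : Measurable (fun p : E × ℝ => x + p.2 • (p.1 - x)) := by fun_prop
        exact (hh.comp this).const_mul _
    -- The endpoint `t = 0`, where the dilation degenerates, is discarded.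
    _ = ∫⁻ t in Ioc (0 : ℝ) 1, ∫⁻ z in closedBall x ρ,
          ENNReal.ofReal ρ * h (x + t • (z - x)) ∂μ ∂volume := by
        rw [restrict_Ioc_eq_restrict_Icc]
    _ ≤ ∫⁻ t in Ioc (0 : ℝ) 1, ENNReal.ofReal ρ * a * μ (closedBall x ρ) := by
        refine setLIntegral_mono' measurableSet_Ioc fun t ht => ?_
        rw [lintegral_const_mul' _ _ ENNReal.ofReal_ne_top, mul_assoc]
        gcongr
        have hpos : ENNReal.ofReal (t ^ Module.finrank ℝ E) ≠ 0 := by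
          simpa using pow_pos ht.1 _
        rw [← ENNReal.mul_le_mul_iff_right hpos ENNReal.ofReal_ne_top,
          setLIntegral_closedBall_homothety h x ht.1]
        have hle : ∫⁻ y in closedBall x (t * ρ), h y ∂μ ≤ a * μ (closedBall x (t * ρ)) := by
          by_contra! hcon
          refine hx ⟨t * ρ, mul_pos ht.1 hρ, ?_, hcon⟩
          calc t * ρ ≤ 1 * ρ := by gcongr; exact ht.2
            _ = ρ := one_mul ρ
        refine hle.trans (le_of_eq ?_)
        have e : μ (closedBall x ρ) = μ (closedBall 0 ρ) := by
          simpa using Measure.addHaar_closedBall_mul μ x zero_le_one hρ.le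
        rw [Measure.addHaar_closedBall_mul μ x ht.1.le hρ.le, e]
        ring
    _ = _ := by simp

/-- A `C¹` function is Lipschitz, with an explicit constant, on the set where the maximal function
of its gradient is bounded. -/
theorem norm_sub_le_of_notMem_maximalSuperlevel {v : E → ℝ} (hv : ContDiff ℝ 1 v)
    {h : E → ℝ≥0∞} (hh : Measurable h) {x y : E} {δ a : ℝ} (ha : 0 ≤ a) (hxy : dist x y ≤ δ)
    (hvx : ∀ z ∈ closedBall x δ, ‖fderiv ℝ v z‖ₑ ≤ h z)
    (hvy : ∀ z ∈ closedBall y δ, ‖fderiv ℝ v z‖ₑ ≤ h z)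
    (hx : x ∉ maximalSuperlevel μ h δ (ENNReal.ofReal a))
    (hy : y ∉ maximalSuperlevel μ h δ (ENNReal.ofReal a)) :
    ‖v x - v y‖ ≤ 2 ^ (Module.finrank ℝ E + 1) * a * ‖x - y‖ := by
  rcases eq_or_ne x y with rfl | hne
  · simp
  set ρ := dist x y with hρdef
  have hρ : 0 < ρ := dist_pos.2 hne
  -- The ball of radius `ρ / 2` about the midpoint lies in both balls of radius `ρ`, and its measure
  -- is `2 ^ (-n)` times theirs. Averaging the triangle inequality over it gives the factor `2 ^ n`,
  -- and the two terms give the remaining 2.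
  set m := midpoint ℝ x y with hm
  have e : ∀ w : E, μ (closedBall w ρ) =
      ENNReal.ofReal (2 ^ Module.finrank ℝ E) * μ (closedBall m (ρ / 2)) := by
    intro w
    have h1 : μ (closedBall m (ρ / 2)) = μ (closedBall 0 (ρ / 2)) := by
      simpa using Measure.addHaar_closedBall_mul μ m zero_le_one (by positivity : 0 ≤ ρ / 2)
    rw [h1, ← Measure.addHaar_closedBall_mul μ w (by norm_num) (by positivity : 0 ≤ ρ / 2)]
    congr 2
    ring
  have hmx : closedBall m (ρ / 2) ⊆ closedBall x ρ := by
    apply closedBall_subset_closedBall'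
    rw [hm, dist_midpoint_left]
    simp only [Real.norm_ofNat]
    linarith
  have hmy : closedBall m (ρ / 2) ⊆ closedBall y ρ := by
    apply closedBall_subset_closedBall'
    rw [hm, dist_midpoint_right]
    simp only [Real.norm_ofNat]
    linarith
  have hX := setLIntegral_closedBall_enorm_sub_le hv hh hρ
    (fun z hz => hvx z (closedBall_subset_closedBall hxy hz))
    (fun hmem => hx (maximalSuperlevel_mono h hxy _ hmem))
  have hY := setLIntegral_closedBall_enorm_sub_le hv hh hρ
    (fun z hz => hvy z (closedBall_subset_closedBall hxy hz))
    (fun hmem => hy (maximalSuperlevel_mono h hxy _ hmem))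
  have hbig : ‖v x - v y‖ₑ * μ (closedBall m (ρ / 2)) ≤
      ENNReal.ofReal (2 ^ (Module.finrank ℝ E + 1) * a * ρ) * μ (closedBall m (ρ / 2)) := by
    calc ‖v x - v y‖ₑ * μ (closedBall m (ρ / 2))
        = ∫⁻ z in closedBall m (ρ / 2), ‖v x - v y‖ₑ ∂μ := by simp
      _ ≤ ∫⁻ z in closedBall m (ρ / 2), (‖v z - v x‖ₑ + ‖v z - v y‖ₑ) ∂μ := by
          refine lintegral_mono fun z => ?_
          have : v x - v y = -(v z - v x) + (v z - v y) := by ring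
          rw [this]
          exact (enorm_add_le _ _).trans (by rw [enorm_neg])
      _ = (∫⁻ z in closedBall m (ρ / 2), ‖v z - v x‖ₑ ∂μ) +
            ∫⁻ z in closedBall m (ρ / 2), ‖v z - v y‖ₑ ∂μ := by
          apply lintegral_add_left
          have := hv.continuous
          fun_prop
      _ ≤ (∫⁻ z in closedBall x ρ, ‖v z - v x‖ₑ ∂μ) +
            ∫⁻ z in closedBall y ρ, ‖v z - v y‖ₑ ∂μ := by
          gcongr
      _ ≤ _ := add_le_add hX hY
      _ = _ := by
          rw [e x, e y, ENNReal.ofReal_mul (by positivity), ENNReal.ofReal_mul (by positivity),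
            pow_succ, ENNReal.ofReal_mul (by positivity), ENNReal.ofReal_ofNat]
          ring
  have h0 : μ (closedBall m (ρ / 2)) ≠ 0 := (measure_closedBall_pos μ m (by positivity)).ne'
  have h1 : μ (closedBall m (ρ / 2)) ≠ ⊤ := measure_closedBall_lt_top.ne
  rw [ENNReal.mul_le_mul_iff_left h0 h1, ← ofReal_norm] at hbig
  rw [← dist_eq_norm x y]
  exact (ENNReal.ofReal_le_ofReal_iff (by positivity)).1 hbig

end MaximalFunction


/-! ### Mollification in `L¹` -/

section Mollification

variable {E : Type*} [NormedAddCommGroup E] [NormedSpace ℝ E] [FiniteDimensional ℝ E]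
  [HasContDiffBump E] [MeasurableSpace E] [BorelSpace E] {μ : Measure E} [μ.IsAddHaarMeasure]
  {F : Type*} [NormedAddCommGroup F] [NormedSpace ℝ F]

open scoped Convolution
open ContinuousLinearMap (lsmul)

/-- Convolution with a normalized bump function is a contraction of `L¹`. -/
theorem ContDiffBump.lintegral_enorm_convolution_le (φ : ContDiffBump (0 : E)) {g : E → F}
    (hg : AEStronglyMeasurable g μ) :
    ∫⁻ x, ‖(φ.normed μ ⋆[lsmul ℝ ℝ, μ] g) x‖ₑ ∂μ ≤ ∫⁻ x, ‖g x‖ₑ ∂μ := by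
  have hφ : AEStronglyMeasurable (φ.normed μ) μ :=
    (φ.continuous_normed (μ := μ)).aestronglyMeasurable
  have hone : ∫⁻ t, ‖φ.normed μ t‖ₑ ∂μ = 1 := by
    have h1 : ∀ t, ‖φ.normed μ t‖ₑ = ENNReal.ofReal (φ.normed μ t) := fun t =>
      Real.enorm_of_nonneg (φ.nonneg_normed t)
    simp_rw [h1]
    rw [← ofReal_integral_eq_lintegral_ofReal φ.integrable_normed
      (Filter.Eventually.of_forall φ.nonneg_normed), φ.integral_normed, ENNReal.ofReal_one]
  calc ∫⁻ x, ‖(φ.normed μ ⋆[lsmul ℝ ℝ, μ] g) x‖ₑ ∂μ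
      ≤ ∫⁻ x, ∫⁻ t, ‖lsmul ℝ ℝ (φ.normed μ t) (g (x - t))‖ₑ ∂μ ∂μ :=
        lintegral_mono fun x => enorm_integral_le_lintegral_enorm _
    _ = ∫⁻ t, ∫⁻ x, ‖lsmul ℝ ℝ (φ.normed μ t) (g (x - t))‖ₑ ∂μ ∂μ :=
        lintegral_lintegral_swap (hφ.convolution_integrand (lsmul ℝ ℝ) hg).enorm
    _ = ∫⁻ t, ‖φ.normed μ t‖ₑ * ∫⁻ x, ‖g x‖ₑ ∂μ ∂μ := by
        refine lintegral_congr fun t => ?_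
        simp only [ContinuousLinearMap.lsmul_apply, enorm_smul]
        rw [lintegral_const_mul' _ _ enorm_ne_top,
          lintegral_sub_right_eq_self (fun x => ‖g x‖ₑ) t]
    _ = ∫⁻ x, ‖g x‖ₑ ∂μ := by
        rw [lintegral_mul_const'' _ hφ.enorm, hone, one_mul]

/-- Mollifications converge in `L¹`. -/
theorem exists_lintegral_enorm_convolution_sub_le [CompleteSpace F] {g : E → F}
    (hg : Integrable g μ) {ε : ℝ≥0∞} (hε : ε ≠ 0) :
    ∃ η > 0, ∀ φ : ContDiffBump (0 : E), φ.rOut < η →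
      ∫⁻ x, ‖(φ.normed μ ⋆[lsmul ℝ ℝ, μ] g) x - g x‖ₑ ∂μ ≤ ε := by
  have hε3 : ε / 3 ≠ 0 := by simp [hε]
  obtain ⟨h, hsupp, hgh, hcont, hint⟩ := hg.exists_hasCompactSupport_lintegral_sub_le hε3
  -- For `φ.rOut < 1` the mollification of `h` vanishes off `K`. A uniform error `δ` on this set of
  -- finite measure therefore costs at most `δ * μ K < ε / 3` in `L¹`.
  set K := cthickening 1 (tsupport h) with hK
  have hKc : IsCompact K := IsCompact.cthickening hsupp
  obtain ⟨δ, hδ, hδK⟩ := ENNReal.exists_nnreal_pos_mul_lt (hKc.measure_lt_top (μ := μ)).ne hε3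
  obtain ⟨η, hη, hη'⟩ := Metric.uniformContinuous_iff.1
    (hsupp.uniformContinuous_of_continuous hcont) δ (by exact_mod_cast hδ)
  refine ⟨min η 1, lt_min hη one_pos, fun φ hφ => ?_⟩
  have hφη := hφ.trans_le (min_le_left _ _)
  have hφ1 := hφ.trans_le (min_le_right _ _)
  have hex : ∀ {k : E → F}, Integrable k μ →
      ConvolutionExists (φ.normed μ) k (lsmul ℝ ℝ) μ := fun hk =>
    φ.hasCompactSupport_normed.convolutionExists_left _ φ.continuous_normed hk.locallyIntegrable
  have hgh' : Integrable (g - h) μ := hg.sub hint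
  have hdecomp : ∀ x, (φ.normed μ ⋆[lsmul ℝ ℝ, μ] g) x - g x =
      (φ.normed μ ⋆[lsmul ℝ ℝ, μ] (g - h)) x +
        ((φ.normed μ ⋆[lsmul ℝ ℝ, μ] h) x - h x) + (h x - g x) := by
    intro x
    have := (hex hgh' x).distrib_add (hex hint x)
    rw [sub_add_cancel] at this
    rw [this]
    abel
  have hnear : ∀ x, ‖(φ.normed μ ⋆[lsmul ℝ ℝ, μ] h) x - h x‖ₑ ≤ K.indicator (fun _ => (δ : ℝ≥0∞)) x := by
    intro x
    by_cases hx : x ∈ K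
    · rw [indicator_of_mem hx, ← edist_eq_enorm_sub, edist_nndist]
      have : dist ((φ.normed μ ⋆[lsmul ℝ ℝ, μ] h) x) (h x) ≤ δ :=
        φ.dist_normed_convolution_le hcont.aestronglyMeasurable fun y hy =>
          (hη' (lt_of_lt_of_le (mem_ball.1 hy) hφη.le)).le
      exact_mod_cast this
    · rw [indicator_of_notMem hx]
      have h0 : ∀ y ∈ ball x φ.rOut, h y = 0 := by
        intro y hy
        by_contra hne
        refine hx (mem_cthickening_of_dist_le x y 1 _ (subset_tsupport h hne) ?_)
        rw [dist_comm]
        exact (mem_ball.1 hy).le.trans hφ1.le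
      have hx0 := h0 x (mem_ball_self φ.rOut_pos)
      have : dist ((φ.normed μ ⋆[lsmul ℝ ℝ, μ] h) x) (h x) ≤ 0 :=
        φ.dist_normed_convolution_le hcont.aestronglyMeasurable fun y hy => by
          rw [h0 y hy, hx0, dist_self]
      rw [dist_le_zero.1 this, sub_self, enorm_zero]
  have hm : AEMeasurable (fun x => ‖(φ.normed μ ⋆[lsmul ℝ ℝ, μ] (g - h)) x‖ₑ) μ :=
    (φ.hasCompactSupport_normed.continuous_convolution_left _ φ.continuous_normed
      hgh'.locallyIntegrable).aestronglyMeasurable.enorm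
  have hm2 : AEMeasurable (K.indicator (fun _ => (δ : ℝ≥0∞))) μ :=
    (measurable_const.indicator hKc.measurableSet).aemeasurable
  calc ∫⁻ x, ‖(φ.normed μ ⋆[lsmul ℝ ℝ, μ] g) x - g x‖ₑ ∂μ
      ≤ ∫⁻ x, (‖(φ.normed μ ⋆[lsmul ℝ ℝ, μ] (g - h)) x‖ₑ +
          K.indicator (fun _ => (δ : ℝ≥0∞)) x + ‖g x - h x‖ₑ) ∂μ := by
        refine lintegral_mono fun x => ?_
        rw [hdecomp x, enorm_sub_rev (g x)]
        refine (enorm_add_le _ _).trans (add_le_add ((enorm_add_le _ _).trans ?_) le_rfl)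
        exact add_le_add le_rfl (hnear x)
    _ = (∫⁻ x, ‖(φ.normed μ ⋆[lsmul ℝ ℝ, μ] (g - h)) x‖ₑ ∂μ) +
          (∫⁻ x, K.indicator (fun _ => (δ : ℝ≥0∞)) x ∂μ) + ∫⁻ x, ‖g x - h x‖ₑ ∂μ := by
        refine (lintegral_add_left' (hm.add hm2) _).trans ?_
        congr 1
        exact lintegral_add_left' hm _
    _ ≤ ε / 3 + ε / 3 + ε / 3 := by
        gcongr
        · exact (φ.lintegral_enorm_convolution_le hgh'.aestronglyMeasurable).trans hgh
        · rw [lintegral_indicator_const hKc.measurableSet]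
          exact hδK.le
    _ = ε := ENNReal.add_thirds ε

end Mollification

/-! ### Mollification of weak gradients -/

section WeakGradient

open scoped Convolution
open ContinuousLinearMap (lsmul)

variable {d : ℕ}

/-- The gradient of a mollification is the mollification of the weak gradient. -/
theorem hasFDerivAt_convolution_of_weakGradient {u : Euc d → ℝ} {g : Euc d → Euc d}
    (hu : IntegrableOn u (unitBall d)) (hg : IntegrableOn g (unitBall d))
    (hw : ∀ (j : Fin d) (φ : Euc d → ℝ), ContDiff ℝ ∞ φ → HasCompactSupport φ →
      tsupport φ ⊆ unitBall d →
      ∫ x in unitBall d, u x * fderiv ℝ φ x (EuclideanSpace.single j 1) =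
        - ∫ x in unitBall d, g x j * φ x)
    (φ : ContDiffBump (0 : Euc d)) {x : Euc d} (hx : closedBall x φ.rOut ⊆ unitBall d) :
    HasFDerivAt (φ.normed volume ⋆[lsmul ℝ ℝ, volume] (unitBall d).indicator u)
      (innerSL ℝ ((φ.normed volume ⋆[lsmul ℝ ℝ, volume] (unitBall d).indicator g) x)) x := by
  have hu' : Integrable ((unitBall d).indicator u) :=
    (integrable_indicator_iff measurableSet_ball).2 hu
  have hg' : Integrable ((unitBall d).indicator g) :=
    (integrable_indicator_iff measurableSet_ball).2 hg
  set ψ := φ.normed (volume : Measure (Euc d)) with hψ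
  have hψc : HasCompactSupport ψ := φ.hasCompactSupport_normed
  have hψs : ContDiff ℝ ∞ ψ := φ.contDiff_normed
  have hψ1 : ContDiff ℝ 1 ψ := φ.contDiff_normed
  have hder := hψc.hasFDerivAt_convolution_left (lsmul ℝ ℝ) hψ1 hu'.locallyIntegrable x
  refine hder.congr_fderiv ?_
  have hcE : ConvolutionExists (fderiv ℝ ψ) ((unitBall d).indicator u)
      ((lsmul ℝ ℝ : ℝ →L[ℝ] ℝ →L[ℝ] ℝ).precompL (Euc d)) volume :=
    (hψc.fderiv ℝ).convolutionExists_left _ (hψ1.continuous_fderiv one_ne_zero)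
      hu'.locallyIntegrable
  have hcG : ConvolutionExists ψ ((unitBall d).indicator g) (lsmul ℝ ℝ) volume :=
    hψc.convolutionExists_left _ hψ1.continuous hg'.locallyIntegrable
  apply ContinuousLinearMap.coe_injective
  refine (EuclideanSpace.basisFun (Fin d) ℝ).toBasis.ext fun j => ?_
  simp only [OrthonormalBasis.coe_toBasis, EuclideanSpace.basisFun_apply,
    ContinuousLinearMap.coe_coe, innerSL_apply_apply, EuclideanSpace.inner_single_right, one_mul,
    conj_trivial]
  -- The reflected and translated mollifier is the test function; the hypothesis on `x` keeps its
  -- support inside the ball, and the reflection accounts for the sign.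
  set χ : Euc d → ℝ := fun y => ψ (x - y) with hχ
  have hχs : ContDiff ℝ ∞ χ := hψs.comp (contDiff_const.sub contDiff_id)
  have hχsupp : tsupport χ ⊆ closedBall x φ.rOut := by
    apply closure_minimal _ isClosed_closedBall
    intro y hy
    have : x - y ∈ Function.support ψ := hy
    rw [hψ, φ.support_normed_eq, mem_ball_zero_iff] at this
    rw [mem_closedBall, dist_comm, dist_eq_norm]
    exact this.le
  have hχc : HasCompactSupport χ :=
    (isCompact_closedBall x φ.rOut).of_isClosed_subset (isClosed_tsupport _) hχsupp
  have hχd : ∀ y, fderiv ℝ χ y (EuclideanSpace.single j 1) =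
      - fderiv ℝ ψ (x - y) (EuclideanSpace.single j 1) := by
    intro y
    have h1 : HasFDerivAt (fun y : Euc d => x - y) (-ContinuousLinearMap.id ℝ (Euc d)) y :=
      (hasFDerivAt_id y).const_sub x
    have h2 := ((hψ1.differentiable one_ne_zero) (x - y)).hasFDerivAt.comp y h1
    have h3 : fderiv ℝ χ y = (fderiv ℝ ψ (x - y)).comp (-ContinuousLinearMap.id ℝ (Euc d)) :=
      h2.fderiv
    simp [h3]
  have key := hw j χ hχs hχc (hχsupp.trans hx)
  have hL : ((fderiv ℝ ψ ⋆[(lsmul ℝ ℝ : ℝ →L[ℝ] ℝ →L[ℝ] ℝ).precompL (Euc d), volume]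
      (unitBall d).indicator u) x) (EuclideanSpace.single j 1) =
      - ∫ y in unitBall d, u y * fderiv ℝ χ y (EuclideanSpace.single j 1) := by
    rw [convolution_def, ContinuousLinearMap.integral_apply (hcE x),
      ← integral_sub_left_eq_self _ volume x, ← integral_neg,
      ← integral_indicator measurableSet_ball]
    refine integral_congr_ae (Filter.Eventually.of_forall fun y => ?_)
    by_cases hy : y ∈ unitBall d
    · simp [indicator_of_mem hy, hχd, mul_comm]
    · simp [indicator_of_notMem hy]
  have hR : ((ψ ⋆[lsmul ℝ ℝ, volume] (unitBall d).indicator g) x) j =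
      ∫ y in unitBall d, g y j * χ y := by
    have hproj := (EuclideanSpace.proj (𝕜 := ℝ) j : Euc d →L[ℝ] ℝ).integral_comp_comm (hcG x)
    rw [convolution_def]
    refine hproj.symm.trans ?_
    rw [← integral_sub_left_eq_self _ volume x, ← integral_indicator measurableSet_ball]
    refine integral_congr_ae (Filter.Eventually.of_forall fun y => ?_)
    by_cases hy : y ∈ unitBall d
    · simp [indicator_of_mem hy, hχ, mul_comm]
    · simp [indicator_of_notMem hy]
  rw [hL, hR, key, neg_neg]

end WeakGradient

/-! ### Lusin-type differentiability of Sobolev functions -/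

section WeakGradient

open scoped Convolution Topology
open ContinuousLinearMap (lsmul)

variable {d : ℕ}

/-- If the increments of a sequence of functions are Lipschitz on `A` near `x` with geometrically
decaying constants, then the pointwise limit is differentiable within `A` at `x`, and its derivative
is the limit of the derivatives. -/
theorem hasFDerivWithinAt_of_tendsto_of_lipschitz {E : Type*} [NormedAddCommGroup E]
    [NormedSpace ℝ E] {A : Set E} {u : E → ℝ} {w : ℕ → E → ℝ} {w' : ℕ → E →L[ℝ] ℝ}
    {L : E →L[ℝ] ℝ} {x : E} {C δ : ℝ} {N : ℕ} (hδ : 0 < δ) (hx : x ∈ A)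
    (hlim : ∀ y ∈ A, Filter.Tendsto (fun k => w k y) Filter.atTop (𝓝 (u y)))
    (hder : ∀ k, HasFDerivAt (w k) (w' k) x)
    (hw' : Filter.Tendsto w' Filter.atTop (𝓝 L))
    (hlip : ∀ y ∈ A, dist x y ≤ δ → ∀ k, N ≤ k →
      |(w (k + 1) x - w k x) - (w (k + 1) y - w k y)| ≤ C * (1 / 2) ^ k * ‖x - y‖) :
    HasFDerivWithinAt u L A x := by
  rw [hasFDerivWithinAt_iff_isLittleO, Asymptotics.isLittleO_iff]
  intro c hc
  -- The error of `u` is split into three parts: the telescoped tail `u - w n`, the error of `w n`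
  -- at `x`, and `w' n - L`. The index `n` is fixed before `y`, so that only the middle part depends
  -- on how close `y` is to `x`.
  have h1 : ∀ᶠ n : ℕ in Filter.atTop, C * (1 / 2) ^ n / (1 - 1 / 2) < c / 3 := by
    have : Filter.Tendsto (fun n : ℕ => C * (1 / 2 : ℝ) ^ n / (1 - 1 / 2)) Filter.atTop
        (𝓝 (C * 0 / (1 - 1 / 2))) :=
      ((tendsto_pow_atTop_nhds_zero_of_lt_one (by norm_num) (by norm_num)).const_mul C).div_const _
    exact this.eventually_lt_const (by simpa using by positivity)
  have h2 : ∀ᶠ n : ℕ in Filter.atTop, ‖w' n - L‖ < c / 3 := by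
    have := (tendsto_iff_norm_sub_tendsto_zero.1 hw')
    exact this.eventually_lt_const (by positivity)
  obtain ⟨n, hn1, hn2, hnN⟩ := (h1.and (h2.and (Filter.eventually_ge_atTop N))).exists
  have h3 := Asymptotics.isLittleO_iff.1 (hasFDerivAt_iff_isLittleO.1 (hder n))
    (by positivity : 0 < c / 3)
  filter_upwards [nhdsWithin_le_nhds h3, nhdsWithin_le_nhds (closedBall_mem_nhds x hδ),
    self_mem_nhdsWithin] with y hy3 hyδ hyA
  have hxy : dist x y ≤ δ := by rw [dist_comm]; exact hyδ
  have hgeo : ∀ k, dist (w (k + n) y - w (k + n) x) (w (k + 1 + n) y - w (k + 1 + n) x) ≤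
      (C * (1 / 2) ^ n * ‖x - y‖) * (1 / 2) ^ k := by
    intro k
    have := hlip y hyA hxy (k + n) (hnN.trans (Nat.le_add_left _ _))
    rw [Real.dist_eq, show k + 1 + n = k + n + 1 by ring]
    calc _ = |(w (k + n + 1) x - w (k + n) x) - (w (k + n + 1) y - w (k + n) y)| := by
          congr 1; ring
      _ ≤ _ := this
      _ = _ := by rw [pow_add]; ring
  have htend : Filter.Tendsto (fun k => w (k + n) y - w (k + n) x) Filter.atTop
      (𝓝 (u y - u x)) :=
    (((Filter.tendsto_add_atTop_iff_nat n).2 (hlim y hyA)).sub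
      ((Filter.tendsto_add_atTop_iff_nat n).2 (hlim x hx)))
  have hfar := dist_le_of_le_geometric_of_tendsto₀ _ _ (by norm_num) hgeo htend
  rw [zero_add, dist_comm, Real.dist_eq] at hfar
  have hfar' : |u y - u x - (w n y - w n x)| ≤ c / 3 * ‖y - x‖ := by
    refine hfar.trans ?_
    rw [norm_sub_rev x y]
    calc C * (1 / 2) ^ n * ‖y - x‖ / (1 - 1 / 2)
        = C * (1 / 2) ^ n / (1 - 1 / 2) * ‖y - x‖ := by ring
      _ ≤ _ := by gcongr
  have hlin : |(w' n - L) (y - x)| ≤ c / 3 * ‖y - x‖ :=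
    ((w' n - L).le_opNorm _).trans (by gcongr)
  rw [Real.norm_eq_abs] at hy3 ⊢
  calc |u y - u x - L (y - x)|
      = |(u y - u x - (w n y - w n x)) + (w n y - w n x - w' n (y - x)) + (w' n - L) (y - x)| := by
        congr 1
        simp only [sub_apply]
        ring
    _ ≤ _ := abs_add_three _ _ _
    _ ≤ c / 3 * ‖y - x‖ + c / 3 * ‖y - x‖ + c / 3 * ‖y - x‖ := by gcongr
    _ = c * ‖y - x‖ := by ring

/-- Lusin-type approximation: an integrable function with an integrable weak gradient is
differentiable, with derivative the weak gradient, within sets of nearly full measure. -/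
theorem exists_hasFDerivWithinAt_of_weakGradient {u : Euc d → ℝ} {g : Euc d → Euc d}
    (hu : IntegrableOn u (unitBall d)) (hg : IntegrableOn g (unitBall d))
    (hw : ∀ (j : Fin d) (φ : Euc d → ℝ), ContDiff ℝ ∞ φ → HasCompactSupport φ →
      tsupport φ ⊆ unitBall d →
      ∫ x in unitBall d, u x * fderiv ℝ φ x (EuclideanSpace.single j 1) =
        - ∫ x in unitBall d, g x j * φ x)
    {δ : ℝ} (hδ : 0 < δ) {ε : ℝ≥0∞} (hε : ε ≠ 0) :
    ∃ A ⊆ ball (0 : Euc d) (1 - 2 * δ), MeasurableSet A ∧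
      volume (ball (0 : Euc d) (1 - 2 * δ) \ A) ≤ ε ∧
      ∀ x ∈ A, HasFDerivWithinAt u (innerSL ℝ (g x)) A x := by
  set u₁ := (unitBall d).indicator u with hu₁
  set g₁ := (unitBall d).indicator g with hg₁
  have hu' : Integrable u₁ := (integrable_indicator_iff measurableSet_ball).2 hu
  have hg' : Integrable g₁ := (integrable_indicator_iff measurableSet_ball).2 hg
  -- The bound by `δ` keeps the mollifier's support in the ball, `1 / (k + 1)` forces convergence,
  -- the ratio of the radii is needed for almost everywhere convergence, and the rate `4 ^ (-k)`
  -- feeds the weak (1,1) inequality.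
  have hchoose : ∀ k : ℕ, ∃ φ : ContDiffBump (0 : Euc d), φ.rOut ≤ δ ∧ φ.rOut ≤ 1 / (k + 1) ∧
      φ.rOut ≤ 2 * φ.rIn ∧
      ∫⁻ x, ‖(φ.normed volume ⋆[lsmul ℝ ℝ, volume] g₁) x - g₁ x‖ₑ ≤
        ENNReal.ofReal ((1 / 4) ^ k) := by
    intro k
    obtain ⟨η, hη, hη'⟩ := exists_lintegral_enorm_convolution_sub_le hg'
      (ε := ENNReal.ofReal ((1 / 4) ^ k)) (by simp)
    set r : ℝ := min (min δ (1 / (k + 1))) (η / 2) with hr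
    have hr0 : 0 < r := by positivity
    refine ⟨⟨r / 2, r, by positivity, by linarith⟩, ?_, ?_, ?_, hη' _ ?_⟩
    · exact (min_le_left _ _).trans (min_le_left _ _)
    · exact (min_le_left _ _).trans (min_le_right _ _)
    · change r ≤ 2 * (r / 2)
      linarith
    · change r < η
      have : r ≤ η / 2 := min_le_right _ _
      linarith
  choose φ hφδ hφk hφK hφg using hchoose
  have hφ0 : Filter.Tendsto (fun k => (φ k).rOut) Filter.atTop (𝓝 0) :=
    squeeze_zero (fun k => (φ k).rOut_pos.le) hφk tendsto_one_div_add_atTop_nhds_zero_nat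
  set w : ℕ → Euc d → ℝ := fun k => (φ k).normed volume ⋆[lsmul ℝ ℝ, volume] u₁ with hwdef
  set G : ℕ → Euc d → Euc d := fun k => (φ k).normed volume ⋆[lsmul ℝ ℝ, volume] g₁ with hGdef
  have hwlim : ∀ᵐ x, Filter.Tendsto (fun k => w k x) Filter.atTop (𝓝 (u₁ x)) :=
    ContDiffBump.ae_convolution_tendsto_right_of_locallyIntegrable hφ0
      (Filter.Eventually.of_forall hφK) hu'.locallyIntegrable
  have hGlim : ∀ᵐ x, Filter.Tendsto (fun k => G k x) Filter.atTop (𝓝 (g₁ x)) :=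
    ContDiffBump.ae_convolution_tendsto_right_of_locallyIntegrable hφ0
      (Filter.Eventually.of_forall hφK) hg'.locallyIntegrable
  have hwC : ∀ k, ContDiff ℝ 1 (w k) := fun k =>
    (φ k).hasCompactSupport_normed.contDiff_convolution_left (n := 1) _
      (φ k).contDiff_normed hu'.locallyIntegrable
  have hGC : ∀ k, Continuous (G k) := fun k =>
    (φ k).hasCompactSupport_normed.continuous_convolution_left _
      (φ k).continuous_normed hg'.locallyIntegrable
  have hwG : ∀ k, ∀ x ∈ ball (0 : Euc d) (1 - δ),
      HasFDerivAt (w k) (innerSL ℝ (G k x)) x := by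
    intro k x hx
    refine hasFDerivAt_convolution_of_weakGradient hu hg hw (φ k) ?_
    refine closedBall_subset_ball' ?_
    have := mem_ball.1 hx
    linarith [hφδ k]
  set h : ℕ → Euc d → ℝ≥0∞ := fun k x => ‖G (k + 1) x - G k x‖ₑ with hh
  have hhm : ∀ k, Measurable (h k) := fun k =>
    ((hGC (k + 1)).sub (hGC k)).enorm.measurable
  have hhint : ∀ k, ∫⁻ x, h k x ≤ ENNReal.ofReal (2 * (1 / 4) ^ k) := by
    intro k
    have hm : AEMeasurable (fun x => ‖G (k + 1) x - g₁ x‖ₑ) volume :=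
      ((hGC (k + 1)).aestronglyMeasurable.sub hg'.aestronglyMeasurable).enorm
    calc ∫⁻ x, h k x ≤ ∫⁻ x, (‖G (k + 1) x - g₁ x‖ₑ + ‖G k x - g₁ x‖ₑ) := by
          refine lintegral_mono fun x => ?_
          rw [enorm_sub_rev (G k x)]
          have : G (k + 1) x - G k x = (G (k + 1) x - g₁ x) + (g₁ x - G k x) := by abel
          simp only [hh, this]
          exact enorm_add_le _ _
      _ = (∫⁻ x, ‖G (k + 1) x - g₁ x‖ₑ) + ∫⁻ x, ‖G k x - g₁ x‖ₑ := lintegral_add_left' hm _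
      _ ≤ ENNReal.ofReal ((1 / 4) ^ (k + 1)) + ENNReal.ofReal ((1 / 4) ^ k) :=
          add_le_add (hφg (k + 1)) (hφg k)
      _ = ENNReal.ofReal ((1 / 4) ^ (k + 1) + (1 / 4) ^ k) :=
          (ENNReal.ofReal_add (by positivity) (by positivity)).symm
      _ ≤ _ := by
          apply ENNReal.ofReal_le_ofReal
          have : (0 : ℝ) < (1 / 4) ^ k := by positivity
          rw [pow_succ]
          linarith
  set n := Module.finrank ℝ (Euc d) with hn
  -- The level `2 ^ (-k)` splits the rate `4 ^ (-k)` evenly: the Lipschitz constants and the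
  -- measures of the exceptional sets both decay geometrically.
  set S : ℕ → Set (Euc d) := fun k =>
    maximalSuperlevel volume (h k) δ (ENNReal.ofReal ((1 / 2) ^ k)) with hS
  have hSle : ∀ k, volume (S k) ≤ ENNReal.ofReal (5 ^ n * 2 * (1 / 2) ^ k) := by
    intro k
    have h1 := mul_measure_maximalSuperlevel_le volume (h k) δ (ENNReal.ofReal ((1 / 2) ^ k))
    have h2 : ENNReal.ofReal ((1 / 2) ^ k) * volume (S k) ≤
        ENNReal.ofReal ((1 / 2) ^ k) * ENNReal.ofReal (5 ^ n * 2 * (1 / 2) ^ k) := by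
      refine h1.trans ?_
      rw [← ENNReal.ofReal_mul (by positivity)]
      calc _ ≤ ENNReal.ofReal (5 ^ n) * ENNReal.ofReal (2 * (1 / 4) ^ k) := by
            gcongr
            exact hhint k
        _ = _ := by
            rw [← ENNReal.ofReal_mul (by positivity)]
            congr 1
            rw [show (1 / 4 : ℝ) = 1 / 2 * (1 / 2) by norm_num, mul_pow]
            ring
    exact (ENNReal.mul_le_mul_iff_right (by simp) ENNReal.ofReal_ne_top).1 h2
  have hsum : ∑' k, volume (S k) ≠ ⊤ := by
    refine ne_top_of_le_ne_top ?_ (ENNReal.tsum_le_tsum hSle)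
    have hs : Summable fun k : ℕ => (5 ^ n * 2 * (1 / 2) ^ k : ℝ) :=
      (summable_geometric_of_lt_one (by norm_num) (by norm_num)).mul_left _
    rw [← ENNReal.ofReal_tsum_of_nonneg (fun k => by positivity) hs]
    exact ENNReal.ofReal_ne_top
  obtain ⟨N, hN⟩ := ((ENNReal.tendsto_sum_nat_add _ hsum).eventually_le_const
    (pos_iff_ne_zero.2 hε)).exists
  set Z : Set (Euc d) := {x | ¬ (Filter.Tendsto (fun k => w k x) Filter.atTop (𝓝 (u₁ x)) ∧
    Filter.Tendsto (fun k => G k x) Filter.atTop (𝓝 (g₁ x)))} with hZ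
  have hZ0 : volume Z = 0 := hwlim.and hGlim
  -- A Borel-Cantelli argument: `N` makes the tail of the summable measures at most `ε`. The
  -- increments with `k < N` are left uncontrolled, since differentiability only needs the tail.
  set bad := Z ∪ ⋃ k, S (k + N) with hbad
  have hbadle : volume bad ≤ ε := by
    calc volume bad ≤ volume Z + volume (⋃ k, S (k + N)) := measure_union_le _ _
      _ ≤ 0 + ∑' k, volume (S (k + N)) := by
          rw [hZ0]
          gcongr
          exact measure_iUnion_le _
      _ ≤ ε := by rw [zero_add]; exact hN
  have hsubball : ball (0 : Euc d) (1 - 2 * δ) ⊆ unitBall d := ball_subset_ball (by linarith)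
  refine ⟨ball 0 (1 - 2 * δ) \ toMeasurable volume bad, sdiff_subset,
    measurableSet_ball.diff (measurableSet_toMeasurable _ _), ?_, ?_⟩
  · calc _ ≤ volume (toMeasurable volume bad) := by
          refine measure_mono fun x hx => ?_
          by_contra hcon
          exact hx.2 ⟨hx.1, hcon⟩
      _ ≤ ε := by rwa [measure_toMeasurable]
  · set A := ball (0 : Euc d) (1 - 2 * δ) \ toMeasurable volume bad with hA
    have hAbad : ∀ y ∈ A, y ∉ bad := fun y hy hyb => hy.2 (subset_toMeasurable _ _ hyb)
    have hAlim : ∀ y ∈ A, Filter.Tendsto (fun k => w k y) Filter.atTop (𝓝 (u y)) ∧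
        Filter.Tendsto (fun k => G k y) Filter.atTop (𝓝 (g y)) := by
      intro y hy
      have hyZ : y ∉ Z := fun h => hAbad y hy (Or.inl h)
      have hyZ' := not_not.1 hyZ
      rwa [hu₁, hg₁, indicator_of_mem (hsubball hy.1), indicator_of_mem (hsubball hy.1)] at hyZ'
    have hAS : ∀ y ∈ A, ∀ k, N ≤ k → y ∉ S k := by
      intro y hy k hk hyS
      refine hAbad y hy (Or.inr (mem_iUnion.2 ⟨k - N, ?_⟩))
      rwa [Nat.sub_add_cancel hk]
    -- This is why `A` stays at distance `2 * δ` from the sphere: one `δ` for the radii of the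
    -- maximal function, one for the mollifiers.
    have hball : ∀ y ∈ A, closedBall y δ ⊆ ball (0 : Euc d) (1 - δ) := by
      intro y hy
      refine closedBall_subset_ball' ?_
      have := mem_ball.1 hy.1
      linarith
    have hnorm : ∀ y ∈ A, ∀ k, ∀ z ∈ closedBall y δ,
        ‖fderiv ℝ (fun x => w (k + 1) x - w k x) z‖ₑ ≤ h k z := by
      intro y hy k z hz
      have hz' := hball y hy hz
      rw [((hwG (k + 1) z hz').fun_sub (hwG k z hz')).fderiv, ← map_sub]
      simp only [hh, ← ofReal_norm, innerSL_apply_norm]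
      exact le_rfl
    intro x hx
    refine hasFDerivWithinAt_of_tendsto_of_lipschitz (C := 2 ^ (n + 1)) (N := N) hδ hx
      (fun y hy => (hAlim y hy).1)
      (fun k => hwG k x (hball x hx (mem_closedBall_self hδ.le)))
      (((innerSL ℝ).continuous.tendsto _).comp (hAlim x hx).2) ?_
    intro y hy hxy k hk
    exact norm_sub_le_of_notMem_maximalSuperlevel ((hwC (k + 1)).sub (hwC k)) (hhm k)
      (by positivity) hxy (hnorm x hx k) (hnorm y hy k) (hAS x hx k hk) (hAS y hy k hk)

end WeakGradient

/-! ### Hadamard's inequality and integrability of the Jacobian -/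

section Determinant

variable {d : ℕ}

theorem frobeniusNorm_nonneg (A : Matrix (Fin d) (Fin d) ℝ) : 0 ≤ frobeniusNorm A :=
  Real.sqrt_nonneg _

theorem frobeniusNorm_sq (A : Matrix (Fin d) (Fin d) ℝ) :
    frobeniusNorm A ^ 2 = ∑ i, ∑ j, A i j ^ 2 :=
  Real.sq_sqrt (by positivity)

/-- Hadamard's inequality for the Frobenius norm. -/
theorem rpow_mul_abs_det_le_frobeniusNorm_pow (A : Matrix (Fin d) (Fin d) ℝ) :
    (d : ℝ) ^ ((d : ℝ) / 2) * |A.det| ≤ frobeniusNorm A ^ d := by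
  rcases Nat.eq_zero_or_pos d with rfl | hd
  · simp
  have hd' : (0 : ℝ) < d := by exact_mod_cast hd
  -- Arithmetic-geometric mean inequality for the eigenvalues of `Aᵀ A`, whose product is `det A ^
  -- 2` and whose sum is the squared Frobenius norm.
  have hps := Matrix.posSemidef_conjTranspose_mul_self A
  set ev := hps.isHermitian.eigenvalues with hev
  have hev0 : ∀ i, 0 ≤ ev i := hps.eigenvalues_nonneg
  have hdet : A.det ^ 2 = ∏ i, ev i := by
    have h : (A.conjTranspose * A).det = ∏ i, ev i :=
      hps.isHermitian.det_eq_prod_eigenvalues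
    rw [Matrix.det_mul, Matrix.det_conjTranspose] at h
    simpa [sq] using h
  have htr : frobeniusNorm A ^ 2 = ∑ i, ev i := by
    have h : (A.conjTranspose * A).trace = ∑ i, ev i :=
      hps.isHermitian.trace_eq_sum_eigenvalues
    rw [frobeniusNorm_sq, Finset.sum_comm]
    simpa [Matrix.trace, Matrix.mul_apply, sq] using h
  have hamgm := Real.geom_mean_le_arith_mean_weighted Finset.univ (fun _ : Fin d => (d : ℝ)⁻¹) ev
    (fun _ _ => by positivity) (by simp [hd'.ne']) (fun i _ => hev0 i)
  rw [Real.finsetProd_rpow _ _ (fun i _ => hev0 i), ← Finset.mul_sum, ← hdet, ← htr] at hamgm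
  have hpow : A.det ^ 2 ≤ ((d : ℝ)⁻¹ * frobeniusNorm A ^ 2) ^ d := by
    calc A.det ^ 2 = ((A.det ^ 2) ^ (d : ℝ)⁻¹) ^ d := by
          rw [Real.rpow_inv_natCast_pow (sq_nonneg _) (by omega)]
      _ ≤ _ := by gcongr
  refine (pow_le_pow_iff_left₀ (by positivity) (pow_nonneg (frobeniusNorm_nonneg A) d)
    two_ne_zero).1 ?_
  rw [mul_pow, sq_abs, ← Real.rpow_natCast ((d : ℝ) ^ ((d : ℝ) / 2)), ← Real.rpow_mul hd'.le]
  rw [show (d : ℝ) / 2 * (2 : ℕ) = (d : ℕ) by push_cast; ring, Real.rpow_natCast]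
  calc (d : ℝ) ^ d * A.det ^ 2 ≤ (d : ℝ) ^ d * ((d : ℝ)⁻¹ * frobeniusNorm A ^ 2) ^ d := by gcongr
    _ = (frobeniusNorm A ^ d) ^ 2 := by
      rw [← mul_pow, mul_inv_cancel_left₀ hd'.ne', ← pow_mul, ← pow_mul, mul_comm]

theorem frobeniusNorm_eq_norm (A : Matrix (Fin d) (Fin d) ℝ) :
    frobeniusNorm A = ‖(WithLp.toLp 2 fun p : Fin d × Fin d => A p.1 p.2 :
      EuclideanSpace ℝ (Fin d × Fin d))‖ := by
  rw [EuclideanSpace.norm_eq, frobeniusNorm, Fintype.sum_prod_type]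
  simp

theorem integrable_frobeniusNorm_pow {μ : Measure (Euc d)} (hd : 1 ≤ d)
    {G : Euc d → Matrix (Fin d) (Fin d) ℝ}
    (hG : ∀ i j, MemLp (fun x => G x i j) (d : ℝ≥0∞) μ) :
    Integrable (fun x => frobeniusNorm (G x) ^ d) μ := by
  simp_rw [frobeniusNorm_eq_norm]
  exact MemLp.integrable_norm_pow (MemLp.of_eval_piLp fun p => hG p.1 p.2) (by omega)

theorem integrable_det {μ : Measure (Euc d)} (hd : 1 ≤ d)
    {G : Euc d → Matrix (Fin d) (Fin d) ℝ}
    (hG : ∀ i j, MemLp (fun x => G x i j) (d : ℝ≥0∞) μ) :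
    Integrable (fun x => (G x).det) μ := by
  refine ((integrable_frobeniusNorm_pow hd hG).const_mul ((d : ℝ) ^ ((d : ℝ) / 2))⁻¹).mono' ?_ ?_
  · simp_rw [Matrix.det_apply']
    exact Finset.aestronglyMeasurable_fun_sum _ fun σ _ =>
      (Finset.aestronglyMeasurable_fun_prod _ fun i _ =>
        (hG (σ i) i).aestronglyMeasurable).const_mul _
  · refine Filter.Eventually.of_forall fun x => ?_
    have hd' : (0 : ℝ) < (d : ℝ) ^ ((d : ℝ) / 2) :=
      Real.rpow_pos_of_pos (by exact_mod_cast hd) _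
    rw [Real.norm_eq_abs, ← div_eq_inv_mul, le_div_iff₀ hd', mul_comm]
    exact rpow_mul_abs_det_le_frobeniusNorm_pow _

end Determinant

/-! ### Area inequality for Sobolev maps -/

section ImageVolume

variable {d : ℕ}

theorem det_toContinuousLinearMap_toEuclideanLin (M : Matrix (Fin d) (Fin d) ℝ) :
    (LinearMap.toContinuousLinearMap (Matrix.toEuclideanLin M)).det = M.det := by
  rw [ContinuousLinearMap.det, LinearMap.coe_toContinuousLinearMap,
    Matrix.toEuclideanLin_eq_toLin_orthonormal, LinearMap.det_toLin]

/-- A Sobolev map is differentiable within countably many measurable sets which cover almost all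
of the ball. -/
theorem IsLdWeakGradient.exists_hasFDerivWithinAt (hd : 1 ≤ d) {f : Euc d → Euc d}
    {G : Euc d → Matrix (Fin d) (Fin d) ℝ} (hf : MemLp f (d : ℝ≥0∞) (ballMeasure d))
    (hG : IsLdWeakGradient f G) :
    ∃ A : ℕ → Set (Euc d), (∀ n, MeasurableSet (A n)) ∧ (∀ n, A n ⊆ unitBall d) ∧
      volume (unitBall d \ ⋃ n, A n) = 0 ∧
      ∀ n, ∀ x ∈ A n, HasFDerivWithinAt f
        (LinearMap.toContinuousLinearMap (Matrix.toEuclideanLin (G x))) (A n) x := by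
  have hd' : (1 : ℝ≥0∞) ≤ (d : ℝ≥0∞) := by exact_mod_cast hd
  have : IsFiniteMeasure (ballMeasure d) := ⟨by
    rw [Measure.restrict_apply_univ]; exact measure_ball_lt_top⟩
  -- Here `δ` is `1 / (n + 1)`; for `n ≤ 1` the ball is empty, which is harmless.
  have hex : ∀ (i : Fin d) (n : ℕ), ∃ A ⊆ ball (0 : Euc d) (1 - 2 * (1 / ((n : ℝ) + 1))),
      MeasurableSet A ∧
      volume (ball (0 : Euc d) (1 - 2 * (1 / ((n : ℝ) + 1))) \ A) ≤ ((n : ℝ≥0∞) + 1)⁻¹ ∧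
      ∀ x ∈ A, HasFDerivWithinAt (fun x => f x i) (innerSL ℝ (WithLp.toLp 2 (G x i) : Euc d)) A x := by
    intro i n
    refine exists_hasFDerivWithinAt_of_weakGradient ?_ ?_ ?_ (by positivity) (by simp)
    · exact (hf.eval_piLp i).integrable hd'
    · exact (MemLp.of_eval_piLp (f := fun x => (WithLp.toLp 2 (G x i) : Euc d))
        fun j => hG.1 i j).integrable hd'
    · exact fun j φ h1 h2 h3 => hG.2 i j φ h1 h2 h3
  choose A hAsub hAm hAvol hAder using hex
  have i₀ : Fin d := ⟨0, hd⟩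
  have hsub : ∀ n, ⋂ i, A i n ⊆ ball (0 : Euc d) (1 - 2 * (1 / ((n : ℝ) + 1))) := fun n x hx =>
    hAsub i₀ n (mem_iInter.1 hx i₀)
  refine ⟨fun n => ⋂ i, A i n, fun n => MeasurableSet.iInter fun i => hAm i n, fun n => ?_, ?_, ?_⟩
  · refine (hsub n).trans (ball_subset_ball ?_)
    have : (0 : ℝ) < 1 / ((n : ℝ) + 1) := by positivity
    linarith
  · have hcov : unitBall d \ ⋃ n, ⋂ i, A i n ⊆
        ⋃ m : ℕ, (ball (0 : Euc d) (1 - 2 * (1 / ((m : ℝ) + 1))) \ ⋃ n, ⋂ i, A i n) := by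
      intro x hx
      have hx1 : 0 < (1 - dist x 0) / 2 := by
        have := mem_ball.1 hx.1
        linarith
      obtain ⟨m, hm⟩ := exists_nat_one_div_lt hx1
      refine mem_iUnion.2 ⟨m, ?_, hx.2⟩
      rw [mem_ball]
      linarith
    refine measure_mono_null hcov (measure_iUnion_null fun m => ?_)
    -- For a fixed ball every later set `A i n` misses at most measure `1 / (n + 1)` of it, so the
    -- part missed by the union is null.
    have hle : ∀ n ≥ m, volume (ball (0 : Euc d) (1 - 2 * (1 / ((m : ℝ) + 1))) \ ⋃ n, ⋂ i, A i n) ≤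
        d * ((n : ℝ≥0∞) + 1)⁻¹ := by
      intro n hn
      have hstep : ball (0 : Euc d) (1 - 2 * (1 / ((m : ℝ) + 1))) \ ⋃ n, ⋂ i, A i n ⊆
          ⋃ i, (ball (0 : Euc d) (1 - 2 * (1 / ((n : ℝ) + 1))) \ A i n) := by
        rintro x ⟨hx1, hx2⟩
        have hx3 : x ∉ ⋂ i, A i n := fun h => hx2 (mem_iUnion.2 ⟨n, h⟩)
        rw [mem_iInter, not_forall] at hx3
        obtain ⟨i, hi⟩ := hx3
        refine mem_iUnion.2 ⟨i, ball_subset_ball ?_ hx1, hi⟩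
        have : 1 / ((n : ℝ) + 1) ≤ 1 / ((m : ℝ) + 1) := by gcongr
        linarith
      calc _ ≤ _ := measure_mono hstep
        _ ≤ ∑' i : Fin d, volume (ball (0 : Euc d) (1 - 2 * (1 / ((n : ℝ) + 1))) \ A i n) :=
          measure_iUnion_le _
        _ ≤ ∑' _ : Fin d, ((n : ℝ≥0∞) + 1)⁻¹ := ENNReal.tsum_le_tsum fun i => hAvol i n
        _ = _ := by simp
    have hlim : Filter.Tendsto (fun n : ℕ => (d : ℝ≥0∞) * ((n : ℝ≥0∞) + 1)⁻¹) Filter.atTop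
        (nhds (d * 0)) := by
      refine ENNReal.Tendsto.const_mul ?_ (Or.inr (by simp))
      have := (Filter.tendsto_add_atTop_iff_nat 1).2 ENNReal.tendsto_inv_nat_nhds_zero
      simpa using this
    rw [mul_zero] at hlim
    exact le_antisymm (ge_of_tendsto hlim (Filter.eventually_atTop.2 ⟨m, hle⟩)) zero_le
  · intro n x hx
    rw [hasFDerivWithinAt_euclidean]
    intro i
    refine ((hAder i n x (mem_iInter.1 hx i)).mono (iInter_subset _ i)).congr_fderiv ?_
    ext y
    simp [Matrix.mulVec, dotProduct, PiLp.inner_apply, mul_comm]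

/-- The volume of the image of a Sobolev map is at most the integral of its Jacobian. -/
theorem IsLdWeakGradient.imageVolume_le (hd : 1 ≤ d) {f : Euc d → Euc d}
    {G : Euc d → Matrix (Fin d) (Fin d) ℝ} (hf : MemLp f (d : ℝ≥0∞) (ballMeasure d))
    (hG : IsLdWeakGradient f G) :
    imageVolume f ≤ ∫⁻ x in unitBall d, ENNReal.ofReal |(G x).det| := by
  obtain ⟨A, hAm, hAsub, hAvol, hAder⟩ := hG.exists_hasFDerivWithinAt hd hf
  have : Nonempty (Fin d) := ⟨⟨0, hd⟩⟩
  set U := ⋃ n, A n with hU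
  -- This representative sends the uncontrolled null set to the single point `0`.
  have hae : U.indicator f =ᵐ[ballMeasure d] f := by
    refine (ae_restrict_iff' measurableSet_ball).2 (measure_mono_null ?_ hAvol)
    intro x hx
    simp only [mem_compl_iff, mem_ofPred_eq, Classical.not_imp] at hx
    exact ⟨hx.1, fun hxU => hx.2 (indicator_of_mem hxU f)⟩
  have himg : U.indicator f '' unitBall d ⊆ {0} ∪ ⋃ n, f '' disjointed A n := by
    rintro _ ⟨x, -, rfl⟩
    by_cases hx : x ∈ U
    · right
      rw [indicator_of_mem hx]
      rw [hU, ← iUnion_disjointed] at hx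
      obtain ⟨n, hn⟩ := mem_iUnion.1 hx
      exact mem_iUnion.2 ⟨n, mem_image_of_mem f hn⟩
    · left
      rw [indicator_of_notMem hx]
      rfl
  have hdm : ∀ n, MeasurableSet (disjointed A n) := MeasurableSet.disjointed hAm
  calc imageVolume f ≤ volume (U.indicator f '' unitBall d) := iInf₂_le (U.indicator f) hae
    _ ≤ volume {(0 : Euc d)} + ∑' n, volume (f '' disjointed A n) :=
        (measure_mono himg).trans ((measure_union_le _ _).trans
          (add_le_add le_rfl (measure_iUnion_le _)))
    _ = ∑' n, volume (f '' disjointed A n) := by rw [measure_singleton, zero_add]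
    -- Differentiability within each piece is enough here, without injectivity; disjointness of the
    -- pieces lets the integrals add up.
    _ ≤ ∑' n, ∫⁻ x in disjointed A n, ENNReal.ofReal |(G x).det| := by
        refine ENNReal.tsum_le_tsum fun n => ?_
        have := addHaar_image_le_lintegral_abs_det_fderiv volume (hdm n) fun x hx =>
          (hAder n x (disjointed_subset A n hx)).mono (disjointed_subset A n)
        simpa only [det_toContinuousLinearMap_toEuclideanLin] using this
    _ = ∫⁻ x in ⋃ n, disjointed A n, ENNReal.ofReal |(G x).det| :=
        (lintegral_iUnion hdm (disjoint_disjointed A) _).symm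
    _ ≤ _ := lintegral_mono_set (by rw [iUnion_disjointed]; exact iUnion_subset hAsub)

end ImageVolume

/-! ### Strict lower bound for the energy -/

section LowerBound

variable {d : ℕ}

theorem isLdWeakGradient_weakGradient {f : LdBall d} (hf : f ∈ sobolevW1d d) :
    IsLdWeakGradient f (weakGradient f) := by
  have h : ∃ G, IsLdWeakGradient f G := hf
  rw [weakGradient, dif_pos h]
  exact h.choose_spec

/-- The energy strictly dominates the integral of the Jacobian. -/
theorem mul_lt_sobolevEnergy (hd : 1 ≤ d) {f : LdBall d} (hf : f ∈ sobolevW1d d) {c : ℝ}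
    (hc : 0 < c) (h : c ≤ ∫ x in unitBall d, |(weakGradient f x).det|) :
    (d : ℝ) ^ ((d : ℝ) / 2) * c < sobolevEnergy f := by
  have hG := isLdWeakGradient_weakGradient hf
  have hdet := integrable_det hd hG.1
  have hfrob := integrable_frobeniusNorm_pow hd hG.1
  have hd0 : d ≠ 0 := by omega
  have h1 : (d : ℝ) ^ ((d : ℝ) / 2) * c ≤
      ∫ x in unitBall d, frobeniusNorm (weakGradient f x) ^ d := by
    calc _ ≤ (d : ℝ) ^ ((d : ℝ) / 2) * ∫ x in unitBall d, |(weakGradient f x).det| := by gcongr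
      _ = ∫ x in unitBall d, (d : ℝ) ^ ((d : ℝ) / 2) * |(weakGradient f x).det| :=
        (integral_const_mul _ _).symm
      _ ≤ _ := integral_mono (hdet.abs.const_mul _) hfrob fun x =>
        rpow_mul_abs_det_le_frobeniusNorm_pow _
  have hfint : Integrable (fun x => ‖f x‖ ^ d) (ballMeasure d) :=
    (Lp.memLp f).integrable_norm_pow hd0
  have h2 : 0 ≤ ∫ x in unitBall d, ‖f x‖ ^ d := integral_nonneg fun x => by positivity
  -- The gradient term alone reaches the bound, so equality forces `∫ |f|^d = 0`.
  refine lt_of_le_of_ne (h1.trans (le_add_of_nonneg_left h2)) fun heq => ?_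
  have h3 : ∫ x in unitBall d, ‖f x‖ ^ d = 0 := by
    rw [sobolevEnergy] at heq
    linarith
  have hf0 : f =ᵐ[ballMeasure d] (0 : Euc d → Euc d) := by
    have := (integral_eq_zero_iff_of_nonneg (fun x => by positivity) hfint).1 h3
    filter_upwards [this] with x hx
    simpa [hd0] using hx
  have hzero : IsLdWeakGradient f (0 : Euc d → Matrix (Fin d) (Fin d) ℝ) := by
    refine ⟨fun i j => by simp, fun i j φ _ _ _ => ?_⟩
    have : (fun x => f x i * fderiv ℝ φ x (EuclideanSpace.single j 1)) =ᵐ[ballMeasure d]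
        fun _ => (0 : ℝ) := by
      filter_upwards [hf0] with x hx
      simp [hx]
    rw [integral_congr_ae this]
    simp
  have hG0 := hG.ae_eq hd hzero
  have : Nonempty (Fin d) := ⟨⟨0, hd⟩⟩
  have h4 : ∫ x in unitBall d, |(weakGradient f x).det| = 0 := by
    refine integral_eq_zero_of_ae ?_
    filter_upwards [hG0] with x hx
    simp [hx, Matrix.det_zero]
  linarith

theorem mul_lt_sobolevEnergy_of_mem_classA (hd : 1 ≤ d) {c : ℝ} (hc : 0 < c) {f : LdBall d}
    (hf : f ∈ classA d c) : (d : ℝ) ^ ((d : ℝ) / 2) * c < sobolevEnergy f := by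
  refine mul_lt_sobolevEnergy hd hf.1 hc ?_
  rw [← hf.2]
  exact (le_abs_self _).trans (abs_integral_le_integral_abs)

theorem mul_lt_sobolevEnergy_of_mem_classB (hd : 1 ≤ d) {c : ℝ} (hc : 0 < c) {f : LdBall d}
    (hf : f ∈ classB d c) : (d : ℝ) ^ ((d : ℝ) / 2) * c < sobolevEnergy f := by
  refine mul_lt_sobolevEnergy hd hf.1 hc ?_
  have hG := isLdWeakGradient_weakGradient hf.1
  have h := hG.imageVolume_le hd (Lp.memLp f)
  have h0 : 0 ≤ ∫ x in unitBall d, |(weakGradient f x).det| := integral_nonneg fun x => abs_nonneg _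
  rwa [hf.2, ← ofReal_integral_eq_lintegral_ofReal (integrable_det hd hG.1).abs
    (Filter.Eventually.of_forall fun x => abs_nonneg _), ENNReal.ofReal_le_ofReal_iff h0] at h

end LowerBound

/-! ### Classical gradients and conformal maps -/

section ClassicalGradient

variable {d : ℕ}

/-- The Jacobian matrix of a linear map in the standard basis. -/
def clmMatrix (L : Euc d →L[ℝ] Euc d) : Matrix (Fin d) (Fin d) ℝ :=
  fun i j => L (EuclideanSpace.single j 1) i

theorem det_clmMatrix (L : Euc d →L[ℝ] Euc d) : (clmMatrix L).det = L.det := by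
  have : clmMatrix L = LinearMap.toMatrix (EuclideanSpace.basisFun (Fin d) ℝ).toBasis
      (EuclideanSpace.basisFun (Fin d) ℝ).toBasis (L : Euc d →ₗ[ℝ] Euc d) := by
    ext i j
    simp [clmMatrix, LinearMap.toMatrix_apply]
  rw [this, LinearMap.det_toMatrix]

/-- Each column is the image of a unit vector and has length `κ`, so the squared Frobenius norm is
`d * κ ^ 2`. This is the equality case of Hadamard's inequality. -/
theorem frobeniusNorm_clmMatrix_of_norm_map {L : Euc d →L[ℝ] Euc d} {κ : ℝ} (hκ : 0 ≤ κ)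
    (hL : ∀ v, ‖L v‖ = κ * ‖v‖) : frobeniusNorm (clmMatrix L) ^ d =
      (d : ℝ) ^ ((d : ℝ) / 2) * κ ^ d := by
  have hsq : frobeniusNorm (clmMatrix L) ^ 2 = (Real.sqrt d * κ) ^ 2 := by
    rw [frobeniusNorm_sq, Finset.sum_comm, mul_pow, Real.sq_sqrt (Nat.cast_nonneg d)]
    have : ∀ j : Fin d, ∑ i, clmMatrix L i j ^ 2 = κ ^ 2 := by
      intro j
      have h := EuclideanSpace.norm_sq_eq (L (EuclideanSpace.single j 1))
      rw [hL] at h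
      simpa [clmMatrix] using h.symm
    simp [this]
  have h : frobeniusNorm (clmMatrix L) = Real.sqrt d * κ :=
    (pow_left_inj₀ (frobeniusNorm_nonneg _) (by positivity) two_ne_zero).1 hsq
  rw [h, mul_pow, Real.sqrt_eq_rpow, ← Real.rpow_natCast ((d : ℝ) ^ (1 / 2 : ℝ)),
    ← Real.rpow_mul (Nat.cast_nonneg d)]
  congr 2
  ring

theorem memLp_of_differentiableAt {f : Euc d → Euc d}
    (hf : ∀ x ∈ unitBall d, DifferentiableAt ℝ f x) {K : ℝ} (hK : ∀ x ∈ unitBall d, ‖f x‖ ≤ K) :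
    MemLp f (d : ℝ≥0∞) (ballMeasure d) := by
  have : IsFiniteMeasure (ballMeasure d) := ⟨by
    rw [Measure.restrict_apply_univ]; exact measure_ball_lt_top⟩
  have hc : ContinuousOn f (unitBall d) := fun x hx => (hf x hx).continuousAt.continuousWithinAt
  exact MemLp.of_bound (hc.aestronglyMeasurable measurableSet_ball) K
    ((ae_restrict_iff' measurableSet_ball).2 (Filter.Eventually.of_forall hK))

/-- The classical gradient of a bounded differentiable map with bounded gradient is its weak
gradient. -/
theorem isLdWeakGradient_fderiv {f : Euc d → Euc d}
    (hf : ∀ x ∈ unitBall d, DifferentiableAt ℝ f x) {K K' : ℝ}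
    (hK : ∀ x ∈ unitBall d, ‖f x‖ ≤ K) (hK' : ∀ x ∈ unitBall d, ‖fderiv ℝ f x‖ ≤ K') :
    IsLdWeakGradient f (fun x => clmMatrix (fderiv ℝ f x)) := by
  have : IsFiniteMeasure (ballMeasure d) := ⟨by
    rw [Measure.restrict_apply_univ]; exact measure_ball_lt_top⟩
  have hmeas : ∀ i j, Measurable fun x => clmMatrix (fderiv ℝ f x) i j := fun i j =>
    (EuclideanSpace.proj (𝕜 := ℝ) i).measurable.comp
      (measurable_fderiv_apply_const ℝ f (EuclideanSpace.single j (1 : ℝ)))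
  have hbound : ∀ i j, ∀ᵐ x ∂(ballMeasure d), ‖clmMatrix (fderiv ℝ f x) i j‖ ≤ K' := by
    intro i j
    refine (ae_restrict_iff' measurableSet_ball).2 (Filter.Eventually.of_forall fun x hx => ?_)
    calc ‖clmMatrix (fderiv ℝ f x) i j‖ ≤ ‖fderiv ℝ f x (EuclideanSpace.single j 1)‖ :=
          PiLp.norm_apply_le _ i
      _ ≤ ‖fderiv ℝ f x‖ * ‖EuclideanSpace.single j (1 : ℝ)‖ := ContinuousLinearMap.le_opNorm _ _
      _ ≤ K' := by simpa using hK' x hx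
  refine ⟨fun i j => MemLp.of_bound (hmeas i j).aestronglyMeasurable K' (hbound i j), ?_⟩
  intro i j φ h1 h2 h3
  have hφ0 : ∀ x ∉ unitBall d, φ x = 0 := fun x hx =>
    image_eq_zero_of_notMem_tsupport fun h => hx (h3 h)
  have hφ0' : ∀ x ∉ unitBall d, fderiv ℝ φ x = 0 := fun x hx =>
    image_eq_zero_of_notMem_tsupport fun h => hx (h3 (tsupport_fderiv_subset ℝ h))
  have hder : ∀ x ∈ unitBall d, fderiv ℝ (fun x => f x i) x (EuclideanSpace.single j 1) =
      clmMatrix (fderiv ℝ f x) i j := by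
    intro x hx
    have := ((EuclideanSpace.proj (𝕜 := ℝ) i : Euc d →L[ℝ] ℝ).hasFDerivAt.comp x
      (hf x hx).hasFDerivAt).fderiv
    change fderiv ℝ ((EuclideanSpace.proj (𝕜 := ℝ) i : Euc d →L[ℝ] ℝ) ∘ f) x _ = _
    rw [this]
    rfl
  have hfi : IntegrableOn (fun x => f x i) (unitBall d) := by
    have hc : ContinuousOn (fun x => f x i) (unitBall d) := fun x hx =>
      ((EuclideanSpace.proj (𝕜 := ℝ) i : Euc d →L[ℝ] ℝ).continuous.continuousAt.comp
        (hf x hx).continuousAt).continuousWithinAt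
    exact Integrable.of_bound (hc.aestronglyMeasurable measurableSet_ball) K
      ((ae_restrict_iff' measurableSet_ball).2 (Filter.Eventually.of_forall fun x hx =>
        (PiLp.norm_apply_le _ i).trans (hK x hx)))
  have hGi : IntegrableOn (fun x => clmMatrix (fderiv ℝ f x) i j) (unitBall d) :=
    Integrable.of_bound (hmeas i j).aestronglyMeasurable K' (hbound i j)
  have hext : ∀ {g ψ : Euc d → ℝ}, IntegrableOn g (unitBall d) → Continuous ψ →
      HasCompactSupport ψ → (∀ x ∉ unitBall d, ψ x = 0) → Integrable fun x => g x * ψ x := by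
    intro g ψ hg hψ hψc hψ0
    obtain ⟨C, hC⟩ := hψ.bounded_above_of_compact_support hψc
    have := hg.mul_bdd hψ.aestronglyMeasurable (Filter.Eventually.of_forall hC)
    refine IntegrableOn.integrable_of_forall_notMem_eq_zero (s := unitBall d) this fun x hx => ?_
    rw [hψ0 x hx, mul_zero]
  have hcφ' : Continuous fun x => fderiv ℝ φ x (EuclideanSpace.single j 1) :=
    (h1.continuous_fderiv (by simp)).clm_apply continuous_const
  have hsφ' : HasCompactSupport fun x => fderiv ℝ φ x (EuclideanSpace.single j 1) :=
    h2.fderiv_apply ℝ _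
  have hint : (fun x => fderiv ℝ (fun x => f x i) x (EuclideanSpace.single j 1) * φ x) =
      fun x => clmMatrix (fderiv ℝ f x) i j * φ x := by
    funext x
    by_cases hx : x ∈ unitBall d
    · rw [hder x hx]
    · rw [hφ0 x hx, mul_zero, mul_zero]
  -- Integration by parts over the whole space asks for differentiability of `f` only on the support
  -- of `φ`, so the behaviour of `f` outside the ball is irrelevant.
  have key := integral_mul_fderiv_eq_neg_fderiv_mul_of_integrable (μ := volume)
    (f := fun x => f x i) (g := φ) (v := EuclideanSpace.single j 1)
    (by rw [hint]; exact hext hGi h1.continuous h2 hφ0)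
    (hext hfi hcφ' hsφ' fun x hx => by rw [hφ0' x hx]; rfl)
    (hext hfi h1.continuous h2 hφ0)
    (fun x hx => ((EuclideanSpace.proj (𝕜 := ℝ) i : Euc d →L[ℝ] ℝ).differentiableAt.comp x
      (hf x (h3 hx))))
    (fun x _ => (h1.differentiable (by simp)) x)
  rw [hint] at key
  rw [setIntegral_eq_integral_of_forall_compl_eq_zero, key,
    setIntegral_eq_integral_of_forall_compl_eq_zero]
  · exact fun x hx => by rw [hφ0 x hx, mul_zero]
  · exact fun x hx => by rw [hφ0' x hx]; simp

theorem IsLdWeakGradient.congr_ae {f g : Euc d → Euc d} {G : Euc d → Matrix (Fin d) (Fin d) ℝ}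
    (hG : IsLdWeakGradient f G) (h : g =ᵐ[ballMeasure d] f) : IsLdWeakGradient g G := by
  refine ⟨hG.1, fun i j φ h1 h2 h3 => ?_⟩
  rw [← hG.2 i j φ h1 h2 h3]
  refine integral_congr_ae ?_
  filter_upwards [h] with x hx
  rw [hx]

/-- An injective, orientation preserving conformal map of the ball whose Jacobian integrates to `c`
lies in both classes, and its gradient attains the conformal lower bound. -/
theorem exists_sobolev_of_conformal (hd : 1 ≤ d) {f : Euc d → Euc d} {κ : Euc d → ℝ} {K K' : ℝ}
    (hf : ∀ x ∈ unitBall d, DifferentiableAt ℝ f x)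
    (hinj : InjOn f (unitBall d)) (hK : ∀ x ∈ unitBall d, ‖f x‖ ≤ K)
    (hκ : ∀ x ∈ unitBall d, 0 ≤ κ x ∧ κ x ≤ K')
    (hnorm : ∀ x ∈ unitBall d, ∀ v, ‖fderiv ℝ f x v‖ = κ x * ‖v‖)
    (hdet : ∀ x ∈ unitBall d, (fderiv ℝ f x).det = κ x ^ d)
    {c : ℝ} (hκc : ∫ x in unitBall d, κ x ^ d = c) :
    ∃ F : LdBall d, F ∈ classA d c ∧ F ∈ classB d c ∧
      sobolevEnergy F = (∫ x in unitBall d, ‖f x‖ ^ d) + (d : ℝ) ^ ((d : ℝ) / 2) * c := by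
  have hLp := memLp_of_differentiableAt hf hK
  have hK' : ∀ x ∈ unitBall d, ‖fderiv ℝ f x‖ ≤ K' := fun x hx =>
    ContinuousLinearMap.opNorm_le_bound _ ((hκ x hx).1.trans (hκ x hx).2) fun v => by
      rw [hnorm x hx v]
      gcongr
      exact (hκ x hx).2
  have hG := isLdWeakGradient_fderiv hf hK hK'
  have hae : hLp.toLp f =ᵐ[ballMeasure d] f := hLp.coeFn_toLp
  have hGF := hG.congr_ae hae
  have hmem : hLp.toLp f ∈ sobolevW1d d := ⟨_, hGF⟩
  have hwG := (isLdWeakGradient_weakGradient hmem).ae_eq hd hGF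
  have hball : ∀ᵐ x ∂(ballMeasure d), x ∈ unitBall d := ae_restrict_mem measurableSet_ball
  refine ⟨hLp.toLp f, ⟨hmem, ?_⟩, ⟨hmem, ?_⟩, ?_⟩
  · rw [← hκc]
    refine integral_congr_ae ?_
    filter_upwards [hwG, hball] with x hx hxb
    rw [hx, det_clmMatrix, hdet x hxb]
  · have hdiff : DifferentiableOn ℝ f (unitBall d) := fun x hx =>
      (hf x hx).differentiableWithinAt
    -- Differentiability makes `f` preserve null sets, so its own image computes the volume;
    -- injectivity turns the area inequality into an equality.
    rw [imageVolume_eq hae.symm fun N hN h0 =>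
        addHaar_image_eq_zero_of_differentiableOn_of_addHaar_eq_zero volume (hdiff.mono hN) h0,
      ← lintegral_abs_det_fderiv_eq_addHaar_image volume measurableSet_ball
        (fun x hx => (hf x hx).hasFDerivAt.hasFDerivWithinAt) hinj, ← hκc]
    have hint : Integrable (fun x => κ x ^ d) (ballMeasure d) := by
      refine (integrable_det hd hG.1).congr ?_
      filter_upwards [hball] with x hxb
      rw [det_clmMatrix, hdet x hxb]
    have hnn : 0 ≤ᵐ[ballMeasure d] fun x => κ x ^ d := by
      filter_upwards [hball] with x hxb
      exact pow_nonneg (hκ x hxb).1 d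
    rw [ofReal_integral_eq_lintegral_ofReal hint hnn]
    refine setLIntegral_congr_fun measurableSet_ball fun x hx => ?_
    simp only [hdet x hx, abs_of_nonneg (pow_nonneg (hκ x hx).1 d)]
  · rw [sobolevEnergy]
    congr 1
    · refine integral_congr_ae ?_
      filter_upwards [hae] with x hx
      rw [hx]
    · rw [← hκc, ← integral_const_mul]
      refine integral_congr_ae ?_
      filter_upwards [hwG, hball] with x hx hxb
      rw [hx, frobeniusNorm_clmMatrix_of_norm_map (hκ x hxb).1 (hnorm x hxb)]

end ClassicalGradient

/-! ### Orientation-preserving inversions -/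

section Bubble

open EuclideanGeometry

variable {d : ℕ}

theorem det_reflection_orthogonal_span_singleton {v : Euc d} (hv : v ≠ 0) :
    LinearMap.det (((ℝ ∙ v)ᗮ.reflection.toLinearEquiv : Euc d ≃ₗ[ℝ] Euc d) :
      Euc d →ₗ[ℝ] Euc d) = -1 := by
  rw [Submodule.det_reflection, Submodule.orthogonal_orthogonal, finrank_span_singleton hv, pow_one]

/-- An inversion with centre `p`, translated and composed with a reflection so as to preserve the
orientation. -/
def bubble (e p : Euc d) (R : ℝ) (x : Euc d) : Euc d :=
  (ℝ ∙ e)ᗮ.reflection (inversion p R x - p)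

theorem hasFDerivAt_bubble (e p : Euc d) (R : ℝ) {x : Euc d} (hx : x ≠ p) :
    HasFDerivAt (bubble e p R) ((R / dist x p) ^ 2 •
      (((ℝ ∙ e)ᗮ.reflection : Euc d →L[ℝ] Euc d) ∘L
        ((ℝ ∙ (x - p))ᗮ.reflection : Euc d →L[ℝ] Euc d))) x := by
  have h1 := (hasFDerivAt_inversion (R := R) hx).sub_const p
  have h2 := (((ℝ ∙ e)ᗮ.reflection : Euc d →L[ℝ] Euc d).hasFDerivAt
    (x := inversion p R x - p)).comp x h1
  refine h2.congr_fderiv ?_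
  rw [ContinuousLinearMap.comp_smul]

theorem norm_bubble (e p : Euc d) (R : ℝ) (x : Euc d) :
    ‖bubble e p R x‖ = R ^ 2 / dist x p := by
  rw [bubble, LinearIsometryEquiv.norm_map, ← dist_eq_norm, dist_inversion_center]

theorem bubble_injective (e p : Euc d) {R : ℝ} (hR : R ≠ 0) :
    Function.Injective (bubble e p R) := fun x y h => by
  have := (ℝ ∙ e)ᗮ.reflection.injective h
  exact inversion_injective p hR (sub_left_injective this)

theorem norm_fderiv_bubble (e p : Euc d) (R : ℝ) {x : Euc d} (hx : x ≠ p) (v : Euc d) :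
    ‖fderiv ℝ (bubble e p R) x v‖ = (R / dist x p) ^ 2 * ‖v‖ := by
  rw [(hasFDerivAt_bubble e p R hx).fderiv]
  simp [norm_smul, div_pow]

/-- The derivative is a multiple of a product of two hyperplane reflections, one from the inversion
and one inserted to correct its sign, each of determinant `-1`. -/
theorem det_fderiv_bubble {e p : Euc d} (he : e ≠ 0) (R : ℝ) {x : Euc d} (hx : x ≠ p) :
    (fderiv ℝ (bubble e p R) x).det = ((R / dist x p) ^ 2) ^ d := by
  rw [(hasFDerivAt_bubble e p R hx).fderiv, ContinuousLinearMap.det]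
  have : (((R / dist x p) ^ 2 • (((ℝ ∙ e)ᗮ.reflection : Euc d →L[ℝ] Euc d) ∘L
        ((ℝ ∙ (x - p))ᗮ.reflection : Euc d →L[ℝ] Euc d)) : Euc d →L[ℝ] Euc d) :
          Euc d →ₗ[ℝ] Euc d) = (R / dist x p) ^ 2 •
      ((((ℝ ∙ e)ᗮ.reflection.toLinearEquiv : Euc d ≃ₗ[ℝ] Euc d) : Euc d →ₗ[ℝ] Euc d) ∘ₗ
        (((ℝ ∙ (x - p))ᗮ.reflection.toLinearEquiv : Euc d ≃ₗ[ℝ] Euc d) :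
          Euc d →ₗ[ℝ] Euc d)) := rfl
  rw [this, LinearMap.det_smul, LinearMap.det_comp, det_reflection_orthogonal_span_singleton he,
    det_reflection_orthogonal_span_singleton (sub_ne_zero.2 hx)]
  simp

end Bubble

/-! ### Concentration at a boundary point -/

section Concentration

variable {d : ℕ}

theorem le_dist_of_mem_unitBall {e : Euc d} (he : ‖e‖ = 1) {t : ℝ} (ht : 0 < t) {x : Euc d}
    (hx : x ∈ unitBall d) : t ≤ dist x ((1 + t) • e) := by
  have h1 : ‖(1 + t) • e‖ = 1 + t := by
    rw [norm_smul, he, mul_one, Real.norm_of_nonneg (by positivity)]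
  have h2 := norm_sub_norm_le ((1 + t) • e) x
  have h3 := mem_ball_zero_iff.1 hx
  rw [dist_comm, dist_eq_norm]
  linarith

/-- The ball of radius `t` about `(1 - t) e` lies in the unit ball and within `3 * t` of the pole.
It contributes at least `t ^ d * (3 * t) ^ (-2 * d)` times the volume of the unit ball, and `t ^
(-d) ≥ t⁻¹`. What matters is the blow-up as `t → 0`. -/
theorem le_setIntegral_one_div_dist_pow (hd : 1 ≤ d) {e : Euc d} (he : ‖e‖ = 1) {t : ℝ}
    (ht : 0 < t) (ht1 : t ≤ 1)
    (hint : IntegrableOn (fun x => ((1 / dist x ((1 + t) • e)) ^ d) ^ 2) (unitBall d)) :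
    volume.real (unitBall d) / 9 ^ d / t ≤
      ∫ x in unitBall d, ((1 / dist x ((1 + t) • e)) ^ d) ^ 2 := by
  set q : Euc d := (1 - t) • e with hq
  have hsub : ball q t ⊆ unitBall d := by
    refine ball_subset_ball' ?_
    rw [dist_zero_right, hq, norm_smul, he, Real.norm_of_nonneg (by linarith)]
    linarith
  have hqp : dist q ((1 + t) • e) = 2 * t := by
    rw [dist_eq_norm, hq, ← sub_smul, norm_smul, he, mul_one, Real.norm_eq_abs,
      show 1 - t - (1 + t) = -(2 * t) by ring, abs_neg, abs_of_pos (by positivity)]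
  have hvol : volume.real (ball q t) = t ^ d * volume.real (unitBall d) := by
    rw [Measure.real, Measure.addHaar_ball_of_pos volume q ht, ENNReal.toReal_mul,
      ENNReal.toReal_ofReal (by positivity), finrank_euclideanSpace_fin]
    rfl
  calc volume.real (unitBall d) / 9 ^ d / t
      ≤ volume.real (unitBall d) / 9 ^ d / t ^ d := by
        gcongr
        exact pow_le_of_le_one ht.le ht1 (by omega)
    _ = ∫ x in ball q t, ((1 / (3 * t)) ^ d) ^ 2 := by
        rw [setIntegral_const, hvol, smul_eq_mul, ← pow_mul, mul_comm d 2, pow_mul, div_pow,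
          mul_pow, div_pow, mul_pow, ← pow_mul t 2 d]
        field_simp
        norm_num [← pow_mul, mul_comm]
    _ ≤ ∫ x in ball q t, ((1 / dist x ((1 + t) • e)) ^ d) ^ 2 := by
        refine setIntegral_mono_on ?_ (hint.mono_set hsub) measurableSet_ball fun x hx => ?_
        · exact integrableOn_const measure_ball_lt_top.ne
        · have h1 := le_dist_of_mem_unitBall he ht (hsub hx)
          have h2 : dist x ((1 + t) • e) ≤ 3 * t := by
            have := dist_triangle x q ((1 + t) • e)
            have := mem_ball.1 hx
            linarith
          gcongr
          linarith
    _ ≤ _ := setIntegral_mono_set hint (Filter.Eventually.of_forall fun x => by positivity)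
        hsub.eventuallyLE

/-- Orientation preserving conformal maps which concentrate at a boundary point have energy
arbitrarily close to the conformal lower bound. -/
theorem exists_sobolevEnergy_le (hd : 1 ≤ d) {c : ℝ} (hc : 0 < c) {ε : ℝ} (hε : 0 < ε) :
    ∃ F : LdBall d, F ∈ classA d c ∧ F ∈ classB d c ∧
      sobolevEnergy F ≤ (d : ℝ) ^ ((d : ℝ) / 2) * c + ε := by
  have hfin : IsFiniteMeasure (ballMeasure d) := ⟨by
    rw [Measure.restrict_apply_univ]; exact measure_ball_lt_top⟩
  set e : Euc d := EuclideanSpace.single ⟨0, hd⟩ 1 with hedef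
  have he : ‖e‖ = 1 := by simp [hedef]
  have he0 : e ≠ 0 := fun h => by simp [h] at he
  set V := volume.real (unitBall d) with hV
  have hVpos : 0 < V := ENNReal.toReal_pos (measure_ball_pos _ _ one_pos).ne'
    measure_ball_lt_top.ne
  -- The condition on `t` is what makes the last error term `c ^ 2 * (V / W) / (2 * ε)` at most `ε /
  -- 2`.
  obtain ⟨t, ht, ht1, htε⟩ : ∃ t : ℝ, 0 < t ∧ t ≤ 1 ∧ c ^ 2 * (9 ^ d * t) ≤ ε ^ 2 := by
    refine ⟨min 1 (ε ^ 2 / (c ^ 2 * 9 ^ d)), by positivity, min_le_left _ _, ?_⟩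
    calc c ^ 2 * (9 ^ d * min 1 (ε ^ 2 / (c ^ 2 * 9 ^ d)))
        ≤ c ^ 2 * (9 ^ d * (ε ^ 2 / (c ^ 2 * 9 ^ d))) := by
          gcongr
          exact min_le_right _ _
      _ = ε ^ 2 := by field_simp
  set p : Euc d := (1 + t) • e with hp
  have hdist : ∀ x ∈ unitBall d, t ≤ dist x p := fun x hx => le_dist_of_mem_unitBall he ht hx
  have hne : ∀ x ∈ unitBall d, x ≠ p := fun x hx => dist_pos.1 (ht.trans_le (hdist x hx))
  set w : Euc d → ℝ := fun x => (1 / dist x p) ^ d with hw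
  have hwc : ContinuousOn w (unitBall d) := by
    refine ContinuousOn.pow (ContinuousOn.div continuousOn_const ?_ ?_) d
    · fun_prop
    · exact fun x hx => (ht.trans_le (hdist x hx)).ne'
  have hwb : ∀ x ∈ unitBall d, w x ≤ (1 / t) ^ d := fun x hx => by
    have := hdist x hx
    simp only [hw]
    gcongr
  have hw0 : ∀ x, 0 ≤ w x := fun x => by positivity
  have hwi : IntegrableOn w (unitBall d) :=
    Integrable.of_bound (hwc.aestronglyMeasurable measurableSet_ball) ((1 / t) ^ d)
      ((ae_restrict_iff' measurableSet_ball).2 (Filter.Eventually.of_forall fun x hx => by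
        rw [Real.norm_of_nonneg (hw0 x)]
        exact hwb x hx))
  have hw2i : IntegrableOn (fun x => w x ^ 2) (unitBall d) :=
    Integrable.of_bound ((hwc.pow 2).aestronglyMeasurable measurableSet_ball) (((1 / t) ^ d) ^ 2)
      ((ae_restrict_iff' measurableSet_ball).2 (Filter.Eventually.of_forall fun x hx => by
        rw [Real.norm_of_nonneg (by positivity)]
        have := hwb x hx
        have := hw0 x
        gcongr))
  set W := ∫ x in unitBall d, w x ^ 2 with hW
  have hWlow : V / 9 ^ d / t ≤ W := le_setIntegral_one_div_dist_pow hd he ht ht1 hw2i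
  have hWpos : 0 < W := lt_of_lt_of_le (by positivity) hWlow
  -- Normalization: inversion of radius `√s` has Jacobian `s ^ d * w ^ 2`, which integrates to `c`
  -- when `s ^ d = c / W`.
  set s := (c / W) ^ (d : ℝ)⁻¹ with hs
  have hspos : 0 < s := Real.rpow_pos_of_pos (div_pos hc hWpos) _
  have hsd : s ^ d = c / W :=
    Real.rpow_inv_natCast_pow (div_pos hc hWpos).le (Nat.one_le_iff_ne_zero.1 hd)
  clear_value s W
  have hR2 : Real.sqrt s ^ 2 = s := Real.sq_sqrt hspos.le
  have hκ : ∀ x, ((Real.sqrt s / dist x p) ^ 2) ^ d = c / W * w x ^ 2 := by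
    intro x
    rw [div_pow, hR2, ← hsd]
    simp only [hw]
    rw [div_pow, ← pow_mul, ← pow_mul, one_div, inv_pow, mul_comm d 2, div_eq_mul_inv]
  have hκc : ∫ x in unitBall d, ((Real.sqrt s / dist x p) ^ 2) ^ d = c := by
    simp_rw [hκ]
    rw [integral_const_mul, ← hW]
    field_simp
  obtain ⟨F, hFA, hFB, hFE⟩ := exists_sobolev_of_conformal hd (f := bubble e p (Real.sqrt s))
    (κ := fun x => (Real.sqrt s / dist x p) ^ 2) (K := s / t) (K' := (Real.sqrt s / t) ^ 2)
    (fun x hx => (hasFDerivAt_bubble e p _ (hne x hx)).differentiableAt)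
    (bubble_injective e p (Real.sqrt_pos.2 hspos).ne').injOn
    (fun x hx => by
      rw [norm_bubble, hR2]
      have := hdist x hx
      gcongr)
    (fun x hx => ⟨by positivity, by
      have := hdist x hx
      gcongr⟩)
    (fun x hx v => norm_fderiv_bubble e p _ (hne x hx) v)
    (fun x hx => det_fderiv_bubble he0 _ (hne x hx)) hκc
  refine ⟨F, hFA, hFB, ?_⟩
  rw [hFE, add_comm]
  gcongr
  have hnorm : ∀ x, ‖bubble e p (Real.sqrt s) x‖ ^ d = c / W * w x := by
    intro x
    rw [norm_bubble, hR2, div_pow, hsd]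
    simp only [hw, div_eq_mul_inv, one_mul, inv_pow]
  simp_rw [hnorm]
  rw [integral_const_mul]
  -- Young's inequality `w ≤ a * w ^ 2 + 1 / (4 * a)` bounds `∫ w` in terms of `W`; this `a` makes
  -- the first term contribute exactly `ε / 2` after multiplication by `c / W`.
  set a := ε / (2 * c) with ha
  have hapos : 0 < a := by positivity
  have hwle : ∫ x in unitBall d, w x ≤ a * W + V * (1 / (4 * a)) := by
    calc ∫ x in unitBall d, w x ≤ ∫ x in unitBall d, (a * w x ^ 2 + 1 / (4 * a)) := by
          refine integral_mono hwi ((hw2i.const_mul a).add (integrable_const _)) fun x => ?_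
          have : a * w x ^ 2 + 1 / (4 * a) - w x = a * (w x - 1 / (2 * a)) ^ 2 := by
            field_simp
            ring
          have h2 : 0 ≤ a * (w x - 1 / (2 * a)) ^ 2 := by positivity
          change w x ≤ a * w x ^ 2 + 1 / (4 * a)
          linarith
      _ = _ := by
          rw [integral_add (hw2i.const_mul a) (integrable_const _), integral_const_mul,
            setIntegral_const, smul_eq_mul, ← hW]
  have hVW : V / W ≤ 9 ^ d * t := by
    rw [div_le_iff₀ hWpos]
    rw [div_div, div_le_iff₀ (by positivity)] at hWlow
    linarith
  calc c / W * ∫ x in unitBall d, w x ≤ c / W * (a * W + V * (1 / (4 * a))) := by gcongr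
    _ = ε / 2 + c ^ 2 * (V / W) / (2 * ε) := by
        rw [ha]
        field_simp
        ring
    _ ≤ ε / 2 + c ^ 2 * (9 ^ d * t) / (2 * ε) := by gcongr
    _ ≤ ε / 2 + ε ^ 2 / (2 * ε) := by gcongr
    _ = ε := by
        field_simp
        ring

end Concentration

end

theorem mainTheorem2 (d : ℕ) (hd : 1 ≤ d) (c : ℝ) (hc : 0 < c) :
    (IsGLB (sobolevEnergy '' classA d c) ((d : ℝ) ^ ((d : ℝ) / 2) * c) ∧
      IsGLB (sobolevEnergy '' classB d c) ((d : ℝ) ^ ((d : ℝ) / 2) * c)) ∧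
    (∀ f ∈ classA d c, sobolevEnergy f ≠ (d : ℝ) ^ ((d : ℝ) / 2) * c) ∧
    (∀ f ∈ classB d c, sobolevEnergy f ≠ (d : ℝ) ^ ((d : ℝ) / 2) * c) := by
  refine ⟨⟨⟨?_, ?_⟩, ⟨?_, ?_⟩⟩, fun f hf => (mul_lt_sobolevEnergy_of_mem_classA hd hc hf).ne',
    fun f hf => (mul_lt_sobolevEnergy_of_mem_classB hd hc hf).ne'⟩
  · rintro _ ⟨f, hf, rfl⟩
    exact (mul_lt_sobolevEnergy_of_mem_classA hd hc hf).le
  · intro b hb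
    refine le_of_forall_pos_le_add fun ε hε => ?_
    obtain ⟨F, hFA, -, hFE⟩ := exists_sobolevEnergy_le hd hc hε
    exact (hb ⟨F, hFA, rfl⟩).trans hFE
  · rintro _ ⟨f, hf, rfl⟩
    exact (mul_lt_sobolevEnergy_of_mem_classB hd hc hf).le
  · intro b hb
    refine le_of_forall_pos_le_add fun ε hε => ?_
    obtain ⟨F, -, hFB, hFE⟩ := exists_sobolevEnergy_le hd hc hε
    exact (hb ⟨F, hFB, rfl⟩).trans hFE
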